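/- For an integer $n>0$ let $E_n\colon y^2=x^3-n^2x$ and $E_{1,n}\colon y^2=x^3+4n^2x$ over $\mathbb{Q}$, let $\varphi_1\colon E_n\to E_{1,n}$ be the $2$-isogeny $(x,y)\mapsto\left(\frac{y^2}{x^2},-\frac{y(n^2+x^2)}{x^2}\right)$ with kernel $\{\infty,(0,0)\}$, and let $\widehat{\varphi_1}\colon E_{1,n}\to E_n$, $(x,y)\mapsto\left(\frac{y^2}{4x^2},\frac{y(4n^2-x^2)}{8x^2}\right)$, be its dual isogeny. Let $T$ and $T_1$ be the torsion subgroups of $E_n(\mathbb{Q})$ and $E_{1,n}(\mathbb{Q})$. Proposition 6.3. Let $n>1$ be an integer that is not a perfect square (for instance, a squarefree integer $n>1$). There exist subgroups $A\subseteq E_n(\mathbb{Q})$ and $A_1\subseteq E_{1,n}(\mathbb{Q})$ such that $E_n(\mathbb{Q})=T\oplus A$, $E_{1,n}(\mathbb{Q})=T_1\oplus A_1$ and $\widehat{\varphi_1}(A_1)\subseteq A$. For every such choice, $A$ and $A_1$ are free abelian groups of the same finite rank $r$, the $\mathbb{F}_2$-vector spaces below are finite-dimensional, and $$\dim_{\mathbb{F}_2}A/\widehat{\varphi_1}(A_1)=\dim_{\mathbb{F}_2}\frac{E_n(\mathbb{Q})}{\widehat{\varphi_1}(E_{1,n}(\mathbb{Q}))}-2,\qquad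 r=\dim_{\mathbb{F}_2}A/2A=\dim_{\mathbb{F}_2}\frac{E_n(\mathbb{Q})}{2E_n(\mathbb{Q})}-2.$$ Moreover, the torsion contributes exactly the four $2$-torsion points: $E_n(\mathbb{Q})[2]=\{\infty,(0,0),(n,0),(-n,0)\}$ has four elements, and the natural maps $E_n(\mathbb{Q})[2]\to T/2T$ and $E_n(\mathbb{Q})[2]\to T/\widehat{\varphi_1}(T_1)$ are bijective. -/

import Mathlib

open WeierstrassCurve

/-- The curve `E_n : y² = x³ - n² x` over `ℚ`. -/
def curveE (n : ℕ) : WeierstrassCurve.Affine ℚ where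
  a₁ := 0
  a₂ := 0
  a₃ := 0
  a₄ := -(n : ℚ) ^ 2
  a₆ := 0

/-- The curve `E_{1,n} : y² = x³ + 4 n² x` over `ℚ`. -/
def curveE₁ (n : ℕ) : WeierstrassCurve.Affine ℚ where
  a₁ := 0
  a₂ := 0
  a₃ := 0
  a₄ := 4 * (n : ℚ) ^ 2
  a₆ := 0

theorem curveE_nonsingular_iff {n : ℕ} {x y : ℚ} : (curveE n).Nonsingular x y ↔
    y ^ 2 = x ^ 3 - n ^ 2 * x ∧ (3 * x ^ 2 ≠ n ^ 2 ∨ y ≠ 0) := by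
  rw [Affine.nonsingular_iff', Affine.equation_iff]
  simp only [curveE]
  constructor
  · rintro ⟨h, h'⟩
    refine ⟨by linarith, ?_⟩
    rcases h' with h' | h'
    · left; intro h2; apply h'; linarith
    · right; intro h2; apply h'; simp [h2]
  · rintro ⟨h, h'⟩
    refine ⟨by linarith, ?_⟩
    rcases h' with h' | h'
    · left; intro h2; apply h'; linarith
    · right; intro h2; apply h'; linarith

theorem curveE₁_nonsingular_iff {n : ℕ} {x y : ℚ} : (curveE₁ n).Nonsingular x y ↔
    y ^ 2 = x ^ 3 + 4 * n ^ 2 * x ∧ (3 * x ^ 2 + 4 * n ^ 2 ≠ 0 ∨ y ≠ 0) := by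
  rw [Affine.nonsingular_iff', Affine.equation_iff]
  simp only [curveE₁]
  constructor
  · rintro ⟨h, h'⟩
    refine ⟨by linarith, ?_⟩
    rcases h' with h' | h'
    · left; intro h2; apply h'; linarith
    · right; intro h2; apply h'; simp [h2]
  · rintro ⟨h, h'⟩
    refine ⟨by linarith, ?_⟩
    rcases h' with h' | h'
    · left; intro h2; apply h'; linarith
    · right; intro h2; apply h'; linarith

theorem phi_nonsingular {n : ℕ} {x y : ℚ} (h : (curveE n).Nonsingular x y) (hx : x ≠ 0) :
    (curveE₁ n).Nonsingular (y ^ 2 / x ^ 2) (-(y * (n ^ 2 + x ^ 2)) / x ^ 2) := by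
  obtain ⟨h1, h2⟩ := curveE_nonsingular_iff.1 h
  rw [curveE₁_nonsingular_iff]
  constructor
  · field_simp
    grind
  · by_cases hy : y = 0
    · left
      have hn : (n : ℚ) ^ 2 = x ^ 2 := by
        have : x * (x ^ 2 - n ^ 2) = 0 := by rw [hy] at h1; linarith
        rcases mul_eq_zero.1 this with h | h
        · exact absurd h hx
        · linarith
      rw [hn]
      positivity
    · right
      have : (n : ℚ) ^ 2 + x ^ 2 ≠ 0 := by positivity
      exact div_ne_zero (neg_ne_zero.2 (mul_ne_zero hy this)) (by positivity)

theorem phiHat_nonsingular {n : ℕ} {x y : ℚ} (h : (curveE₁ n).Nonsingular x y) (hx : x ≠ 0) :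
    (curveE n).Nonsingular (y ^ 2 / (4 * x ^ 2)) (y * (4 * n ^ 2 - x ^ 2) / (8 * x ^ 2)) := by
  obtain ⟨h1, h2⟩ := curveE₁_nonsingular_iff.1 h
  rw [curveE_nonsingular_iff]
  have hpos : 0 < x ^ 2 + 4 * (n : ℚ) ^ 2 := by positivity
  have hy : y ≠ 0 := by
    rintro rfl
    have : x * (x ^ 2 + 4 * n ^ 2) = 0 := by linarith
    rcases mul_eq_zero.1 this with h | h
    · exact hx h
    · exact hpos.ne' h
  constructor
  · field_simp
    grind
  · by_cases hxn : 4 * (n : ℚ) ^ 2 - x ^ 2 = 0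
    · left
      have hn : (n : ℚ) ^ 2 = x ^ 2 / 4 := by linarith
      have : y ^ 2 / (4 * x ^ 2) = x / 2 := by
        rw [h1]; field_simp; linarith
      rw [this, hn]
      intro h
      apply hx
      nlinarith
    · right
      exact div_ne_zero (mul_ne_zero hy hxn) (by positivity)

/-- The `2`-isogeny `φ₁ : E_n → E_{1,n}`, `(x, y) ↦ (y²/x², -y(n² + x²)/x²)`, on rational
points; its kernel is `{∞, (0,0)}`. -/
noncomputable def phiFun (n : ℕ) : (curveE n).Point → (curveE₁ n).Point
  | .zero => 0
  | .some x y h => if hx : x = 0 then 0 else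
      .some (y ^ 2 / x ^ 2) (-(y * (n ^ 2 + x ^ 2)) / x ^ 2) (phi_nonsingular h hx)

/-- The dual isogeny `φ̂₁ : E_{1,n} → E_n`, `(x, y) ↦ (y²/(4x²), y(4n² - x²)/(8x²))`, on rational
points; its kernel is `{∞, (0,0)}`. It is dual to `φ₁`: both composites are multiplication by `2`
(`phiHatFun_phiFun`, `phiFun_phiHatFun`), and it is additive (`phiHatFun_add`). -/
noncomputable def phiHatFun (n : ℕ) : (curveE₁ n).Point → (curveE n).Point
  | .zero => 0
  | .some x y h => if hx : x = 0 then 0 else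
      .some (y ^ 2 / (4 * x ^ 2)) (y * (4 * n ^ 2 - x ^ 2) / (8 * x ^ 2)) (phiHat_nonsingular h hx)

theorem phiHatFun_zero (n : ℕ) : phiHatFun n 0 = 0 := rfl

theorem phiHatFun_some {n : ℕ} {x y : ℚ} (h : (curveE₁ n).Nonsingular x y) (hx : x ≠ 0) :
    phiHatFun n (.some x y h) = .some (y ^ 2 / (4 * x ^ 2)) (y * (4 * n ^ 2 - x ^ 2) / (8 * x ^ 2))
      (phiHat_nonsingular h hx) := dif_neg hx

theorem phiHatFun_some_zero {n : ℕ} {y : ℚ} (h : (curveE₁ n).Nonsingular 0 y) :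
    phiHatFun n (.some 0 y h) = 0 := by
  simp [phiHatFun]

theorem phiHatFun_neg (n : ℕ) (P : (curveE₁ n).Point) : phiHatFun n (-P) = -phiHatFun n P := by
  match P with
  | .zero => rfl
  | .some x y h =>
    rw [Affine.Point.neg_some]
    by_cases hx : x = 0
    · subst hx
      rw [phiHatFun_some_zero, phiHatFun_some_zero, neg_zero]
    · rw [phiHatFun_some _ hx, phiHatFun_some _ hx, Affine.Point.neg_some, Affine.Point.some.injEq]
      simp only [Affine.negY, curveE, curveE₁]
      constructor <;> ring

/-- Translation by `(0,0)` does not change the image under `φ̂₁`. -/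
theorem phiHatFun_add_two_torsion {n : ℕ} {x y y₀ : ℚ} (h₀ : (curveE₁ n).Nonsingular 0 y₀)
    (h : (curveE₁ n).Nonsingular x y) (hx : x ≠ 0) :
    phiHatFun n (.some 0 y₀ h₀ + .some x y h) = phiHatFun n (.some x y h) := by
  obtain ⟨h1, h2⟩ := curveE₁_nonsingular_iff.1 h
  obtain ⟨h3, h4⟩ := curveE₁_nonsingular_iff.1 h₀
  have hy₀ : y₀ = 0 := by
    have : y₀ ^ 2 = 0 := by rw [h3]; ring
    exact pow_eq_zero_iff (two_ne_zero) |>.1 this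
  subst hy₀
  have hn : (n : ℚ) ≠ 0 := by
    rcases h4 with h | h
    · intro h'; simp [h'] at h
    · simp at h
  have hsl : (curveE₁ n).slope 0 x 0 y = y / x := by
    rw [Affine.slope_of_X_ne hx.symm]; field_simp; ring
  have hX : (curveE₁ n).addX 0 x ((curveE₁ n).slope 0 x 0 y) = 4 * n ^ 2 / x := by
    rw [hsl]; simp only [Affine.addX, curveE₁]; field_simp; grind
  have hY : (curveE₁ n).addY 0 x 0 ((curveE₁ n).slope 0 x 0 y) = - 4 * n ^ 2 * y / x ^ 2 := by
    rw [Affine.addY, Affine.negAddY, hX, hsl]; simp only [Affine.negY, curveE₁]; field_simp; ring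
  have hX0 : 4 * (n : ℚ) ^ 2 / x ≠ 0 := by positivity
  rw [Affine.Point.add_of_X_ne hx.symm, phiHatFun_some _ hx, phiHatFun_some _ (by rw [hX]; exact hX0),
    Affine.Point.some.injEq]
  rw [hX, hY]
  constructor
  · field_simp
  · field_simp; ring

theorem phiHatFun_phiFun (n : ℕ) (P : (curveE n).Point) : phiHatFun n (phiFun n P) = 2 • P := by
  match P with
  | .zero => exact (smul_zero (A := (curveE n).Point) 2).symm
  | .some x y h =>
    obtain ⟨h1, h2⟩ := curveE_nonsingular_iff.1 h
    rw [two_smul]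
    by_cases hy : y = 0
    · subst hy
      rw [Affine.Point.add_self_of_Y_eq (by simp [Affine.negY, curveE])]
      by_cases hx : x = 0
      · subst hx
        simp [phiFun, phiHatFun_zero]
      · simp [phiFun, hx, phiHatFun]
    · have hx : x ≠ 0 := by
        rintro rfl
        apply hy
        have : y ^ 2 = 0 := by rw [h1]; ring
        exact pow_eq_zero_iff (two_ne_zero) |>.1 this
      have hyn : y ≠ (curveE n).negY x y := by
        simp only [Affine.negY, curveE]
        intro h
        apply hy
        linarith
      have hsl : (curveE n).slope x x y y = (3 * x ^ 2 - n ^ 2) / (2 * y) := by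
        rw [Affine.slope_of_Y_ne rfl hyn]
        simp only [Affine.negY, curveE]
        congr 1 <;> ring
      rw [phiFun, dif_neg hx, phiHatFun_some _ (by positivity), Affine.Point.add_self_of_Y_ne hyn,
        Affine.Point.some.injEq, Affine.addY, Affine.negAddY, hsl]
      simp only [Affine.negY, Affine.addX, curveE]
      constructor
      · field_simp
        grind
      · field_simp
        grind

theorem alg_aux {a s p q : ℚ} (ha : a ≠ 0) (hp : p ≠ 0) (hq : q ≠ 0)
    (hr : s * (2 * (2 * a - p * q)) = a * (p ^ 2 + q ^ 2)) {L l v x₃ : ℚ}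
    (hL : L = (p * (3 * q ^ 2 + p ^ 2) / 4 - s * p - a * q) / (2 * p * q))
    (hl : l = (s * p / a + q) / 2) (hv : v = l - a / p) (hx₃ : x₃ = l ^ 2 - s) :
    v ^ 2 / 4 = L ^ 2 - (p ^ 2 + q ^ 2) / 8 ∧
    v * (v ^ 2 - 2 * x₃) / 8 = L * (v ^ 2 / 4 - ((q + p) / 2) ^ 2 / 4) +
      ((q + p) / 2) * (((q + p) / 2) ^ 2 - (s + a)) / 8 := by
  have hd : 2 * a - p * q ≠ 0 := by
    intro hd
    rw [hd] at hr
    have : p ^ 2 + q ^ 2 = 0 := by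
      have : a * (p ^ 2 + q ^ 2) = 0 := by linarith
      simpa [ha] using this
    have : 0 < p ^ 2 + q ^ 2 := by positivity
    linarith
  have hs : s = a * (p ^ 2 + q ^ 2) / (2 * (2 * a - p * q)) := by
    rw [eq_div_iff (by simpa using hd)]; exact hr
  obtain ⟨d, hd'⟩ : ∃ d, d = 2 * a - p * q := ⟨_, rfl⟩
  obtain rfl : a = (d + p * q) / 2 := by linarith
  rw [← hd'] at hd hs
  have ha' : d + p * q ≠ 0 := fun h => ha (by rw [h]; simp)
  clear hr hd' ha
  subst hx₃ hv hl hL hs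
  constructor
  · field_simp
    ring
  · field_simp
    ring

theorem alg {x₁ x₂ w₁ w₂ : ℚ} (hx : x₁ - x₂ ≠ 0) (hw : w₁ - w₂ ≠ 0) (hw' : w₁ + w₂ ≠ 0)
    (hr : x₁ * w₁ ^ 2 - x₁ ^ 2 = x₂ * w₂ ^ 2 - x₂ ^ 2) {L l v x₃ : ℚ}
    (hL : L = (w₁ ^ 3 - w₂ ^ 3 - 2 * (x₁ * w₁ - x₂ * w₂)) / (2 * (w₁ - w₂) * (w₁ + w₂)))
    (hl : l = (x₁ * w₁ - x₂ * w₂) / (x₁ - x₂)) (hv : v = l - (x₁ - x₂) / (w₁ - w₂))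
    (hx₃ : x₃ = l ^ 2 - x₁ - x₂) :
    v ^ 2 / 4 = L ^ 2 - w₁ ^ 2 / 4 - w₂ ^ 2 / 4 ∧
    v * (v ^ 2 - 2 * x₃) / 8 = L * (v ^ 2 / 4 - w₁ ^ 2 / 4) + w₁ * (w₁ ^ 2 - 2 * x₁) / 8 := by
  have := alg_aux (a := x₁ - x₂) (s := x₁ + x₂) (p := w₁ - w₂) (q := w₁ + w₂) hx hw hw'
    (by linear_combination -4 * hr) (L := L) (l := l) (v := v) (x₃ := x₃)
    (by rw [hL]; congr 1; ring) (by rw [hl]; field_simp; ring) hv (by rw [hx₃]; ring)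
  obtain ⟨h1, h2⟩ := this
  constructor
  · rw [h1]; ring
  · rw [h2]; ring

theorem phiFun_phiHatFun (n : ℕ) (P : (curveE₁ n).Point) : phiFun n (phiHatFun n P) = 2 • P := by
  match P with
  | .zero => exact (smul_zero (A := (curveE₁ n).Point) 2).symm
  | .some x y h =>
    obtain ⟨h1, h2⟩ := curveE₁_nonsingular_iff.1 h
    rw [two_smul]
    by_cases hx : x = 0
    · subst hx
      have hy : y = 0 := by
        have : y ^ 2 = 0 := by rw [h1]; ring
        exact pow_eq_zero_iff (two_ne_zero) |>.1 this
      subst hy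
      rw [Affine.Point.add_self_of_Y_eq (by simp [Affine.negY, curveE₁]), phiHatFun_some_zero]
      rfl
    · have hy : y ≠ 0 := by
        rintro rfl
        have hpos : 0 < x ^ 2 + 4 * (n : ℚ) ^ 2 := by positivity
        have : x * (x ^ 2 + 4 * n ^ 2) = 0 := by linarith
        rcases mul_eq_zero.1 this with h | h
        · exact hx h
        · exact hpos.ne' h
      have hyn : y ≠ (curveE₁ n).negY x y := by
        simp only [Affine.negY, curveE₁]
        intro h
        apply hy
        linarith
      have hsl : (curveE₁ n).slope x x y y = (3 * x ^ 2 + 4 * n ^ 2) / (2 * y) := by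
        rw [Affine.slope_of_Y_ne rfl hyn]
        simp only [Affine.negY, curveE₁]
        congr 1 <;> ring
      rw [phiHatFun_some _ hx, phiFun, dif_neg (by positivity), Affine.Point.add_self_of_Y_ne hyn,
        Affine.Point.some.injEq, Affine.addY, Affine.negAddY, hsl]
      simp only [Affine.negY, Affine.addX, curveE₁]
      constructor
      · field_simp
        grind
      · field_simp
        grind

theorem phiHatFun_two_smul (n : ℕ) (P : (curveE₁ n).Point) :
    phiHatFun n (2 • P) = 2 • phiHatFun n P := by
  rw [← phiFun_phiHatFun, phiHatFun_phiFun]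

theorem phiHatFun_add_two_torsion' {n : ℕ} {y₀ : ℚ} (h₀ : (curveE₁ n).Nonsingular 0 y₀)
    (P : (curveE₁ n).Point) : phiHatFun n (.some 0 y₀ h₀ + P) = phiHatFun n P := by
  match P with
  | .zero => exact (congrArg _ (add_zero _)).trans (phiHatFun_some_zero h₀)
  | .some x y h =>
    by_cases hx : x = 0
    · subst hx
      have hy : ∀ {z : ℚ}, (curveE₁ n).Nonsingular 0 z → z = 0 := by
        intro z hz
        have : z ^ 2 = 0 := by rw [(curveE₁_nonsingular_iff.1 hz).1]; ring
        exact pow_eq_zero_iff (two_ne_zero) |>.1 this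
      obtain rfl := hy h
      obtain rfl := hy h₀
      rw [Affine.Point.add_self_of_Y_eq (by simp [Affine.negY, curveE₁]), phiHatFun_some_zero,
        phiHatFun_zero]
    · exact phiHatFun_add_two_torsion h₀ h hx

theorem phiHatFun_add_generic {n : ℕ} {x₁ y₁ x₂ y₂ : ℚ} (h₁ : (curveE₁ n).Nonsingular x₁ y₁)
    (h₂ : (curveE₁ n).Nonsingular x₂ y₂) (hx₁ : x₁ ≠ 0) (hx₂ : x₂ ≠ 0) (hx : x₁ ≠ x₂)
    (hxx : x₁ * x₂ ≠ 4 * (n : ℚ) ^ 2) :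
    phiHatFun n (.some x₁ y₁ h₁ + .some x₂ y₂ h₂) =
      phiHatFun n (.some x₁ y₁ h₁) + phiHatFun n (.some x₂ y₂ h₂) := by
  obtain ⟨e₁, -⟩ := curveE₁_nonsingular_iff.1 h₁
  obtain ⟨e₂, -⟩ := curveE₁_nonsingular_iff.1 h₂
  obtain ⟨w₁, rfl⟩ : ∃ w, y₁ = x₁ * w := ⟨y₁ / x₁, by field_simp⟩
  obtain ⟨w₂, rfl⟩ : ∃ w, y₂ = x₂ * w := ⟨y₂ / x₂, by field_simp⟩
  have f₁ : 4 * (n : ℚ) ^ 2 = x₁ * w₁ ^ 2 - x₁ ^ 2 := by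
    apply mul_left_cancel₀ hx₁; linear_combination - e₁
  have f₂ : 4 * (n : ℚ) ^ 2 = x₂ * w₂ ^ 2 - x₂ ^ 2 := by
    apply mul_left_cancel₀ hx₂; linear_combination - e₂
  have hr := f₁.symm.trans f₂
  have hsub : x₁ - x₂ ≠ 0 := sub_ne_zero.2 hx
  have hww : (w₁ - w₂) * (w₁ + w₂) ≠ 0 := by
    intro h
    have : (x₁ - x₂) * (x₁ * x₂ - 4 * n ^ 2) = 0 := by
      have hw : w₁ ^ 2 = w₂ ^ 2 := by linear_combination h
      rw [hw] at f₁
      linear_combination x₂ * f₁ - x₁ * f₂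
    rcases mul_eq_zero.1 this with h | h
    · exact hsub h
    · exact hxx (sub_eq_zero.1 h)
  have hw := left_ne_zero_of_mul hww
  have hw' := right_ne_zero_of_mul hww
  have hsl : (curveE₁ n).slope x₁ x₂ (x₁ * w₁) (x₂ * w₂) = (x₁ * w₁ - x₂ * w₂) / (x₁ - x₂) :=
    Affine.slope_of_X_ne hx
  have X1 : (x₁ * w₁) ^ 2 / (4 * x₁ ^ 2) = w₁ ^ 2 / 4 := by field_simp
  have X2 : (x₂ * w₂) ^ 2 / (4 * x₂ ^ 2) = w₂ ^ 2 / 4 := by field_simp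
  have Y1 : (x₁ * w₁) * (4 * n ^ 2 - x₁ ^ 2) / (8 * x₁ ^ 2) = w₁ * (w₁ ^ 2 - 2 * x₁) / 8 := by
    rw [f₁]; field_simp; ring
  have Y2 : (x₂ * w₂) * (4 * n ^ 2 - x₂ ^ 2) / (8 * x₂ ^ 2) = w₂ * (w₂ ^ 2 - 2 * x₂) / 8 := by
    rw [f₂]; field_simp; ring
  have hX : (x₁ * w₁) ^ 2 / (4 * x₁ ^ 2) ≠ (x₂ * w₂) ^ 2 / (4 * x₂ ^ 2) := by
    rw [X1, X2]; intro h; apply hww; linear_combination 4 * h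
  obtain ⟨l, hl⟩ : ∃ l, l = (x₁ * w₁ - x₂ * w₂) / (x₁ - x₂) := ⟨_, rfl⟩
  obtain ⟨v, hv⟩ : ∃ v, v = l - (x₁ - x₂) / (w₁ - w₂) := ⟨_, rfl⟩
  obtain ⟨x₃, hx₃⟩ : ∃ x₃, x₃ = l ^ 2 - x₁ - x₂ := ⟨_, rfl⟩
  obtain ⟨L, hL⟩ : ∃ L, L = (w₁ ^ 3 - w₂ ^ 3 - 2 * (x₁ * w₁ - x₂ * w₂)) /
    (2 * (w₁ - w₂) * (w₁ + w₂)) := ⟨_, rfl⟩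
  obtain ⟨A1, A2⟩ := alg hsub hw hw' hr hL hl hv hx₃
  have hx3X : (curveE₁ n).addX x₁ x₂ ((curveE₁ n).slope x₁ x₂ (x₁ * w₁) (x₂ * w₂)) = x₃ := by
    rw [hsl, ← hl]; simp only [Affine.addX, curveE₁]; rw [hx₃]; ring
  have hm : l - w₁ = x₂ * (w₁ - w₂) / (x₁ - x₂) := by rw [hl]; field_simp; ring
  have hx₃' : x₃ = x₁ * x₂ * ((w₁ - w₂) / (x₁ - x₂)) ^ 2 := by
    rw [hx₃, hl]
    field_simp
    linear_combination (x₁ - x₂) * hr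
  have hx₃0 : x₃ ≠ 0 := by
    rw [hx₃']
    exact mul_ne_zero (mul_ne_zero hx₁ hx₂) (pow_ne_zero _ (div_ne_zero hw hsub))
  have hy3 : (curveE₁ n).addY x₁ x₂ (x₁ * w₁)
      ((curveE₁ n).slope x₁ x₂ (x₁ * w₁) (x₂ * w₂)) = -(x₃ * v) := by
    rw [Affine.addY, Affine.negAddY, hx3X, hsl, ← hl]
    simp only [Affine.negY, curveE₁]
    have : x₃ * ((x₁ - x₂) / (w₁ - w₂)) = x₁ * x₂ * (w₁ - w₂) / (x₁ - x₂) := by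
      rw [hx₃']; field_simp
    have h5 : x₃ * v = x₃ * l - x₁ * x₂ * (w₁ - w₂) / (x₁ - x₂) := by rw [hv, mul_sub, this]
    rw [h5]
    have h6 : x₁ * x₂ * (w₁ - w₂) / (x₁ - x₂) = x₁ * (l - w₁) := by rw [hm]; ring
    rw [h6]; ring
  have f₃ : 4 * (n : ℚ) ^ 2 = x₃ * v ^ 2 - x₃ ^ 2 := by
    have h3 := Affine.nonsingular_add h₁ h₂ (fun h => hx h.1)
    rw [hx3X, hy3] at h3
    obtain ⟨e₃, -⟩ := curveE₁_nonsingular_iff.1 h3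
    apply mul_left_cancel₀ hx₃0; linear_combination - e₃
  have hSL : (curveE n).slope (w₁ ^ 2 / 4) (w₂ ^ 2 / 4) (w₁ * (w₁ ^ 2 - 2 * x₁) / 8)
      (w₂ * (w₂ ^ 2 - 2 * x₂) / 8) = L := by
    rw [X1, X2] at hX
    have : w₁ ^ 2 / 4 - w₂ ^ 2 / 4 = (w₁ - w₂) * (w₁ + w₂) / 4 := by ring
    rw [Affine.slope_of_X_ne hX, hL, this]
    field_simp
    ring
  have X3 : (-(x₃ * v)) ^ 2 / (4 * x₃ ^ 2) = v ^ 2 / 4 := by field_simp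
  have Y3 : (-(x₃ * v)) * (4 * n ^ 2 - x₃ ^ 2) / (8 * x₃ ^ 2) = -(v * (v ^ 2 - 2 * x₃) / 8) := by
    rw [f₃]; field_simp; ring
  rw [Affine.Point.add_of_X_ne hx, phiHatFun_some h₁ hx₁, phiHatFun_some h₂ hx₂,
    phiHatFun_some _ (by rw [hx3X]; exact hx₃0), Affine.Point.add_of_X_ne hX,
    Affine.Point.some.injEq, hx3X, hy3, X1, X2, Y1, Y2, X3, Y3, hSL]
  simp only [Affine.addY, Affine.negAddY, Affine.negY, Affine.addX, curveE]
  constructor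
  · rw [A1]; ring
  · rw [A2, A1]; ring

theorem phiHatFun_add (n : ℕ) (P Q : (curveE₁ n).Point) :
    phiHatFun n (P + Q) = phiHatFun n P + phiHatFun n Q := by
  match P, Q with
  | .zero, Q =>
    exact (congrArg _ (zero_add Q)).trans (zero_add _).symm
  | .some x y h, .zero =>
    exact (congrArg _ (add_zero _)).trans (add_zero _).symm
  | .some x₁ y₁ h₁, .some x₂ y₂ h₂ =>
    by_cases hx₁ : x₁ = 0
    · subst hx₁
      rw [phiHatFun_add_two_torsion', phiHatFun_some_zero, zero_add]
    by_cases hx₂ : x₂ = 0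
    · subst hx₂
      rw [add_comm, phiHatFun_add_two_torsion', phiHatFun_some_zero, add_zero]
    by_cases hx : x₁ = x₂
    · rcases Affine.Point.X_eq_iff (h₁ := h₁) (h₂ := h₂) |>.1 hx with h | h
      · rw [h, ← two_smul ℕ, ← two_smul ℕ, phiHatFun_two_smul]
      · rw [h, neg_add_cancel, phiHatFun_neg, neg_add_cancel, phiHatFun_zero]
    by_cases hxx : x₁ * x₂ = 4 * (n : ℚ) ^ 2
    · have hn : 4 * (n : ℚ) ^ 2 ≠ 0 := by rw [← hxx]; exact mul_ne_zero hx₁ hx₂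
      have h₀ : (curveE₁ n).Nonsingular 0 0 := by
        rw [curveE₁_nonsingular_iff]
        exact ⟨by ring, Or.inl (by simpa using hn)⟩
      have hne : (0 : ℚ) ≠ x₁ := Ne.symm hx₁
      have hT := Affine.Point.add_of_X_ne (h₁ := h₀) (h₂ := h₁) hne
      have hX : (curveE₁ n).addX 0 x₁ ((curveE₁ n).slope 0 x₁ 0 y₁) = x₂ := by
        rw [Affine.slope_of_X_ne hne]
        simp only [Affine.addX, curveE₁]
        have e₁ := (curveE₁_nonsingular_iff.1 h₁).1
        field_simp
        linear_combination e₁ - x₁ * hxx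
      have hcases := (Affine.Point.X_eq_iff (h₁ := h₂)
        (h₂ := Affine.nonsingular_add h₀ h₁ (fun h => hne h.1))).1 hX.symm
      rw [← hT] at hcases
      rcases hcases with h | h
      · rw [h, add_left_comm, phiHatFun_add_two_torsion', phiHatFun_add_two_torsion',
          ← two_smul ℕ, ← two_smul ℕ, phiHatFun_two_smul]
      · rw [h, phiHatFun_neg, phiHatFun_add_two_torsion', add_neg_cancel, neg_add_rev,
          add_neg_cancel_left, phiHatFun_neg, phiHatFun_some_zero, neg_zero]
    · exact phiHatFun_add_generic h₁ h₂ hx₁ hx₂ hx hxx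

/-- The dual isogeny `φ̂₁` on rational points, as a group homomorphism `E_{1,n}(ℚ) → E_n(ℚ)`. -/
noncomputable def phiHat (n : ℕ) : (curveE₁ n).Point →+ (curveE n).Point where
  toFun := phiHatFun n
  map_zero' := phiHatFun_zero n
  map_add' := phiHatFun_add n

/-- `φ̂₁(E_{1,n}(ℚ))` contains `2 E_n(ℚ)`. -/
theorem two_nsmul_mem_range_phiHat (n : ℕ) (P : (curveE n).Point) :
    2 • P ∈ (phiHat n).range :=
  ⟨phiFun n P, phiHatFun_phiFun n P⟩

/-- The structure of an `𝔽₂`-vector space on `E_n(ℚ)/φ̂₁(E_{1,n}(ℚ))`. -/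
noncomputable instance moduleQuotientRangePhiHat (n : ℕ) :
    Module (ZMod 2) ((curveE n).Point ⧸ (phiHat n).range) :=
  QuotientAddGroup.zmodModule (two_nsmul_mem_range_phiHat n)

/-- The torsion subgroup `T` of `E_n(ℚ)`. -/
abbrev torsionE (n : ℕ) : AddSubgroup (curveE n).Point :=
  AddCommGroup.torsion (curveE n).Point

/-- The torsion subgroup `T₁` of `E_{1,n}(ℚ)`. -/
abbrev torsionE₁ (n : ℕ) : AddSubgroup (curveE₁ n).Point :=
  AddCommGroup.torsion (curveE₁ n).Point

/-- A choice of subgroups `A ⊆ E_n(ℚ)` and `A₁ ⊆ E_{1,n}(ℚ)` such that `E_n(ℚ)` is the internal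
direct sum of `T` and `A`, `E_{1,n}(ℚ)` is the internal direct sum of `T₁` and `A₁`, and
`φ̂₁(A₁) ⊆ A`. -/
structure TorsionSplitting (n : ℕ) where
  A : AddSubgroup (curveE n).Point
  A₁ : AddSubgroup (curveE₁ n).Point
  isCompl : IsCompl (torsionE n) A
  isCompl₁ : IsCompl (torsionE₁ n) A₁
  map_le : A₁.map (phiHat n) ≤ A

namespace TorsionSplitting

/-- `φ̂₁(A₁)`, as a subgroup of `A`. -/
noncomputable def image {n : ℕ} (D : TorsionSplitting n) : AddSubgroup D.A :=
  (D.A₁.map (phiHat n)).addSubgroupOf D.A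

theorem two_nsmul_mem_image {n : ℕ} (D : TorsionSplitting n) (a : D.A) : 2 • a ∈ D.image := by
  have htop : phiFun n a ∈ torsionE₁ n ⊔ D.A₁ := by
    rw [D.isCompl₁.sup_eq_top]; trivial
  obtain ⟨t, ht, b, hb, htb⟩ := AddSubgroup.mem_sup.1 htop
  have h2 : phiHat n t + phiHat n b = 2 • (a : (curveE n).Point) := by
    rw [← map_add, htb]; exact phiHatFun_phiFun n a
  have hbA : phiHat n b ∈ D.A := D.map_le ⟨b, hb, rfl⟩
  have htA : phiHat n t ∈ D.A := by
    rw [eq_sub_of_add_eq h2]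
    exact D.A.sub_mem (D.A.nsmul_mem a.2 2) hbA
  have htT : phiHat n t ∈ torsionE n := (phiHat n).isOfFinAddOrder ht
  have h0 : phiHat n t = 0 := (AddSubgroup.disjoint_def.1 D.isCompl.disjoint) htT htA
  rw [image, AddSubgroup.mem_addSubgroupOf]
  refine ⟨b, hb, ?_⟩
  rw [h0, zero_add] at h2
  simpa using h2

/-- The structure of an `𝔽₂`-vector space on `A/φ̂₁(A₁)`. -/
noncomputable instance {n : ℕ} (D : TorsionSplitting n) : Module (ZMod 2) (D.A ⧸ D.image) :=
  QuotientAddGroup.zmodModule D.two_nsmul_mem_image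

end TorsionSplitting

/-- The subgroup `E_n(ℚ)[2]`. -/
abbrev twoTorsionE (n : ℕ) : AddSubgroup (curveE n).Point :=
  AddSubgroup.torsionBy (curveE n).Point 2

theorem twoTorsionE_le (n : ℕ) : twoTorsionE n ≤ torsionE n := fun _ hP =>
  isOfFinAddOrder_iff_nsmul_eq_zero.2
    ⟨2, two_pos, AddSubgroup.torsionBy.nsmul_iff.1 hP⟩

/-- The inclusion `E_n(ℚ)[2] → T`. -/
def twoTorsionInclusion (n : ℕ) : twoTorsionE n →+ torsionE n :=
  AddSubgroup.inclusion (twoTorsionE_le n)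

/-- `φ̂₁(T₁)`, as a subgroup of `T` (note that `φ̂₁(T₁) ⊆ T`). -/
noncomputable def torsionImage (n : ℕ) : AddSubgroup (torsionE n) :=
  ((torsionE₁ n).map (phiHat n)).addSubgroupOf (torsionE n)

/-! Everything rests on two facts about torsion. First, `T = E_n(ℚ)[2]`: if `y ≠ 0`, repeated
doubling drives the `2`-adic valuation of `x / n` to `-∞`, so the point has infinite order
(`curveE_not_isOfFinAddOrder`). Second, `T₁ = ker φ̂₁` when `n` is not a square: any other torsion
point of `E_{1,n}` would have `x = ±2n`, hence `y² = ±16n³` (`phiHat_eq_zero_of_mem_torsionE₁`).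

Let `B = φ̂₁(E_{1,n}(ℚ))`. It contains `2E_n(ℚ)` and meets `T` trivially, so `T` embeds in the
`𝔽₂`-space `E_n(ℚ)/B`; pulling back a linear complement gives `A ⊇ B`. By Mordell–Weil `B` is free
of finite rank, so `φ̂₁` splits onto `B` and `A₁` exists.

For every splitting `φ̂₁(A₁) = B` and `A₁ ≅ B`, while `2A ⊆ B ⊆ A` forces equal ranks. Since `|T| =
4` and `2T = 0`, both `[E_n(ℚ) : B]` and `[E_n(ℚ) : 2E_n(ℚ)]` are four times the corresponding index
in `A`, which is the shift by `2` in the dimensions.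

Mordell–Weil is needed only for `E_n`. It is proved by complete `2`-descent
(`finiteIndex_range_nsmul_two`) and the naive height (`logHeight_xRep_parallelogram`). -/

/-! ### Torsion of `E_n` by `2`-adic growth under doubling. -/

theorem padicValRat_two_odd_intCast {k : ℤ} : padicValRat 2 ((2 * k + 1 : ℤ) : ℚ) = 0 := by
  rw [padicValRat.of_int, padicValInt.eq_zero_of_not_dvd (by push_cast; omega)]
  rfl

/-- Such a `u` is a quotient of odd integers, and odd squares are `1` modulo `4`. -/
theorem padicValRat_two_sq_add_one_of_eq_zero {u : ℚ} (hu0 : u ≠ 0) (hu1 : u ^ 2 - 1 ≠ 0)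
    (hv : padicValRat 2 u = 0) :
    padicValRat 2 (u ^ 2 + 1) = 1 ∧ 2 ≤ padicValRat 2 (u ^ 2 - 1) := by
  have : Fact (Nat.Prime 2) := ⟨Nat.prime_two⟩
  have hodd : ¬ (2 : ℤ) ∣ u.num ∧ ¬ (2 : ℤ) ∣ (u.den : ℤ) := by
    have hd0 : u.den ≠ 0 := u.den_nz
    have hn0 : u.num ≠ 0 := Rat.num_ne_zero.2 hu0
    have hcop : Nat.Coprime u.num.natAbs u.den := u.reduced
    rw [padicValRat_def, sub_eq_zero, Nat.cast_inj, padicValInt] at hv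
    by_cases h : 2 ∣ u.den
    · have h1 := (dvd_iff_padicValNat_ne_zero (p := 2) hd0).1 h
      rw [← hv] at h1
      have h2 := (dvd_iff_padicValNat_ne_zero (p := 2) (Int.natAbs_ne_zero.2 hn0)).2 h1
      exact absurd (Nat.dvd_gcd h2 h) (by rw [hcop]; decide)
    · refine ⟨fun h' => h ?_, fun h' => h (by exact_mod_cast h')⟩
      have h2 : 2 ∣ u.num.natAbs := by omega
      have h1 := (dvd_iff_padicValNat_ne_zero (p := 2) (Int.natAbs_ne_zero.2 hn0)).1 h2
      rw [hv] at h1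
      exact (dvd_iff_padicValNat_ne_zero (p := 2) hd0).2 h1
  obtain ⟨k, hk⟩ : ∃ k, u.num = 2 * k + 1 := ⟨u.num / 2, by omega⟩
  obtain ⟨l, hl⟩ : ∃ l, (u.den : ℤ) = 2 * l + 1 := ⟨(u.den : ℤ) / 2, by omega⟩
  have hu : u = ((2 * k + 1 : ℤ) : ℚ) / ((2 * l + 1 : ℤ) : ℚ) := by
    rw [← hk, ← hl, Int.cast_natCast, Rat.num_div_den]
  have hl0 : ((2 * l + 1 : ℤ) : ℚ) ≠ 0 := by
    rw [← hl]; exact_mod_cast u.den_nz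
  have hden : padicValRat 2 (((2 * l + 1 : ℤ) : ℚ) ^ 2) = 0 := by
    rw [padicValRat.pow, padicValRat_two_odd_intCast, mul_zero]
  have h2 : padicValRat 2 (2 : ℚ) = 1 := padicValRat.self one_lt_two
  constructor
  · have e : u ^ 2 + 1 = 2 * ((2 * (k ^ 2 + k + l ^ 2 + l) + 1 : ℤ) : ℚ) /
        ((2 * l + 1 : ℤ) : ℚ) ^ 2 := by
      rw [hu]; field_simp; push_cast; ring
    have h0 : ((2 * (k ^ 2 + k + l ^ 2 + l) + 1 : ℤ) : ℚ) ≠ 0 := by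
      rw [Int.cast_ne_zero]; omega
    rw [e, padicValRat.div (mul_ne_zero two_ne_zero h0) (pow_ne_zero 2 hl0),
      padicValRat.mul two_ne_zero h0, hden, h2, padicValRat_two_odd_intCast]
    norm_num
  · have e : u ^ 2 - 1 = 2 * 2 * ((k ^ 2 + k - l ^ 2 - l : ℤ) : ℚ) /
        ((2 * l + 1 : ℤ) : ℚ) ^ 2 := by
      rw [hu]; field_simp; push_cast; ring
    have h0 : ((k ^ 2 + k - l ^ 2 - l : ℤ) : ℚ) ≠ 0 := by
      intro h; rw [h] at e; exact hu1 (by rw [e]; simp)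
    rw [e, padicValRat.div (mul_ne_zero (by norm_num) h0) (pow_ne_zero 2 hl0),
      padicValRat.mul (by norm_num) h0, padicValRat.mul two_ne_zero two_ne_zero, hden, h2,
      padicValRat.of_int]
    omega

/-- The `2`-adic valuation of the `x`-coordinate, normalised by `n`, becomes negative under
doubling, and decreases if it is negative already. -/
theorem padicValRat_two_doubling_lt {u : ℚ} (hu0 : u ≠ 0) (hu1 : u ^ 2 - 1 ≠ 0) :
    padicValRat 2 ((u ^ 2 + 1) ^ 2 / (4 * (u * (u ^ 2 - 1)))) < min 0 (padicValRat 2 u) := by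
  have : Fact (Nat.Prime 2) := ⟨Nat.prime_two⟩
  have hp : u ^ 2 + 1 ≠ 0 := by positivity
  have h4 : padicValRat 2 (4 : ℚ) = 2 := by
    rw [show (4 : ℚ) = ((2 : ℕ) : ℚ) ^ 2 by norm_num, padicValRat.pow,
      padicValRat.self one_lt_two]; rfl
  have hd : padicValRat 2 ((u ^ 2 + 1) ^ 2 / (4 * (u * (u ^ 2 - 1)))) =
      2 * padicValRat 2 (u ^ 2 + 1) - (2 + (padicValRat 2 u + padicValRat 2 (u ^ 2 - 1))) := by
    rw [padicValRat.div (pow_ne_zero 2 hp) (by positivity), padicValRat.pow,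
      padicValRat.mul (by norm_num) (mul_ne_zero hu0 hu1), padicValRat.mul hu0 hu1, h4]
    rfl
  rw [hd]
  -- With `v` the valuation of `u`, that of the quotient is at most `2 - (2 + 0 + 2) = -2` if `v =
  -- 0`, equals `-2 - v` if `v > 0`, and equals `4v - (2 + 3v) = v - 2` if `v < 0`.
  by_cases hv : padicValRat 2 u = 0
  · obtain ⟨h1, h2⟩ := padicValRat_two_sq_add_one_of_eq_zero hu0 hu1 hv
    omega
  · have hsq : padicValRat 2 (u ^ 2) = 2 * padicValRat 2 u := by rw [padicValRat.pow]; rfl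
    have hone : padicValRat 2 (-1 : ℚ) = 0 := by rw [padicValRat.neg, padicValRat.one]
    have h1 : padicValRat 2 (u ^ 2 + 1) = min (2 * padicValRat 2 u) 0 := by
      rw [padicValRat.add_eq_min hp (pow_ne_zero 2 hu0) one_ne_zero
        (by rw [hsq, padicValRat.one]; omega), hsq, padicValRat.one]
    have h2 : padicValRat 2 (u ^ 2 - 1) = min (2 * padicValRat 2 u) 0 := by
      rw [sub_eq_add_neg] at hu1 ⊢
      rw [padicValRat.add_eq_min hu1 (pow_ne_zero 2 hu0) (by norm_num)
        (by rw [hsq, hone]; omega), hsq, hone]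
    omega

theorem curveE_two_nsmul {n : ℕ} {x y : ℚ} (h : (curveE n).Nonsingular x y) (hy : y ≠ 0) :
    ∃ (y' : ℚ) (h' : (curveE n).Nonsingular ((x ^ 2 + n ^ 2) ^ 2 / (4 * y ^ 2)) y'),
      2 • (Affine.Point.some x y h) = .some _ y' h' := by
  obtain ⟨h1, -⟩ := curveE_nonsingular_iff.1 h
  have hyn : y ≠ (curveE n).negY x y := by
    simp only [Affine.negY, curveE]
    intro h
    apply hy
    linarith
  have hsl : (curveE n).slope x x y y = (3 * x ^ 2 - n ^ 2) / (2 * y) := by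
    rw [Affine.slope_of_Y_ne rfl hyn]
    simp only [Affine.negY, curveE]
    congr 1 <;> ring
  have hX : (curveE n).addX x x ((curveE n).slope x x y y) =
      (x ^ 2 + n ^ 2) ^ 2 / (4 * y ^ 2) := by
    rw [hsl]
    simp only [Affine.addX, curveE]
    field_simp
    grind
  refine ⟨_, hX ▸ Affine.nonsingular_add h h (fun h => hyn h.2), ?_⟩
  rw [two_smul, Affine.Point.add_self_of_Y_ne hyn, Affine.Point.some.injEq]
  exact ⟨hX, rfl⟩

theorem curveE_two_nsmul_eq_zero_iff {n : ℕ} {x y : ℚ} (h : (curveE n).Nonsingular x y) :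
    2 • (Affine.Point.some x y h) = 0 ↔ y = 0 := by
  refine ⟨fun h0 => ?_, fun hy => ?_⟩
  · by_contra hy
    obtain ⟨y', h', e⟩ := curveE_two_nsmul h hy
    rw [e] at h0
    exact Affine.Point.some_ne_zero h' h0
  · subst hy
    rw [two_smul, Affine.Point.add_self_of_Y_eq (by simp [Affine.negY, curveE])]

theorem curveE_doubling_descent {n : ℕ} (hn : n ≠ 0) {x y : ℚ} (h : (curveE n).Nonsingular x y)
    (hy : y ≠ 0) :
    ∃ (x' y' : ℚ) (h' : (curveE n).Nonsingular x' y'), y' ≠ 0 ∧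
      2 • (Affine.Point.some x y h) = .some x' y' h' ∧
      padicValRat 2 (x' / n) < min 0 (padicValRat 2 (x / n)) := by
  obtain ⟨y', h', e⟩ := curveE_two_nsmul h hy
  have hn' : (n : ℚ) ≠ 0 := by exact_mod_cast hn
  have h1 := (curveE_nonsingular_iff.1 h).1
  have hx : x ≠ 0 := by
    rintro rfl
    exact hy (pow_eq_zero_iff two_ne_zero |>.1 (by rw [h1]; ring))
  have hx2 : (x / n) ^ 2 - 1 ≠ 0 := by
    intro h0
    have : x ^ 2 = n ^ 2 := by field_simp at h0; linarith
    exact hy (pow_eq_zero_iff two_ne_zero |>.1 (by rw [h1]; linear_combination x * this))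
  have key := padicValRat_two_doubling_lt (div_ne_zero hx hn') hx2
  have hD : (x ^ 2 + n ^ 2) ^ 2 / (4 * y ^ 2) / n =
      ((x / n) ^ 2 + 1) ^ 2 / (4 * (x / n * ((x / n) ^ 2 - 1))) := by
    rw [h1]
    have h3 : x ^ 3 - n ^ 2 * x ≠ 0 := h1 ▸ pow_ne_zero 2 hy
    have h4 : x ^ 2 - n ^ 2 ≠ 0 := by
      intro h0; apply h3; linear_combination x * h0
    have h5 : x ^ 3 - n ^ 2 * x = x * (x ^ 2 - n ^ 2) := by ring
    rw [h5]
    field_simp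
  rw [← hD] at key
  refine ⟨_, y', h', ?_, e, key⟩
  -- If the double had `y' = 0`, its nonzero `x`-coordinate would be `±n`, of normalised valuation
  -- `0`; but that valuation is negative.
  rintro rfl
  have h0 := (curveE_nonsingular_iff.1 h').1
  generalize hX : (x ^ 2 + (n : ℚ) ^ 2) ^ 2 / (4 * y ^ 2) = X at *
  have hX0 : X ≠ 0 := by rw [← hX]; positivity
  have hX2 : (X - n) * (X + n) = 0 := by
    have : X * ((X - n) * (X + n)) = 0 := by linear_combination -h0
    exact (mul_eq_zero.1 this).resolve_left hX0
  have hval : padicValRat 2 (X / n) = 0 := by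
    rcases mul_eq_zero.1 hX2 with h | h
    · rw [sub_eq_zero.1 h, div_self hn', padicValRat.one]
    · rw [eq_neg_of_add_eq_zero_left h, neg_div, div_self hn', padicValRat.neg, padicValRat.one]
  omega

/-- The normalised valuation at `2 ^ k • P` is at most its initial value minus `k`, whereas finitely
many multiples would give only finitely many valuations. -/
theorem curveE_not_isOfFinAddOrder {n : ℕ} (hn : n ≠ 0) {x y : ℚ}
    (h : (curveE n).Nonsingular x y) (hy : y ≠ 0) :
    ¬ IsOfFinAddOrder (Affine.Point.some x y h) := by
  intro hfin
  have key : ∀ k : ℕ, ∃ (x' y' : ℚ) (h' : (curveE n).Nonsingular x' y'), y' ≠ 0 ∧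
      2 ^ k • (Affine.Point.some x y h) = .some x' y' h' ∧
      padicValRat 2 (x' / n) ≤ padicValRat 2 (x / n) - k := by
    intro k
    induction k with
    | zero => exact ⟨x, y, h, hy, by simp, by simp⟩
    | succ k ih =>
      obtain ⟨x₁, y₁, h₁, hy₁, e₁, v₁⟩ := ih
      obtain ⟨x₂, y₂, h₂, hy₂, e₂, v₂⟩ := curveE_doubling_descent hn h₁ hy₁
      refine ⟨x₂, y₂, h₂, hy₂, by rw [pow_succ, mul_comm, mul_nsmul', e₁, e₂], ?_⟩
      push_cast
      omega
  choose X Y H hY e v using key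
  have hfinite := finite_multiples.2 hfin
  have hsub : (Set.range fun k => padicValRat 2 (X k / n)) ⊆
      (fun P : (curveE n).Point => padicValRat 2 (P.xRep 0 / n)) ''
        (AddSubmonoid.multiples (Affine.Point.some x y h) : Set (curveE n).Point) := by
    rintro _ ⟨k, rfl⟩
    exact ⟨_, ⟨2 ^ k, rfl⟩, by simp [e]⟩
  obtain ⟨b, hb⟩ := ((hfinite.image _).subset hsub).bddBelow
  -- The exponent is chosen to push the valuation to at most `b - 1`; truncation by `toNat` can only
  -- enlarge it.
  have h1 := hb ⟨(padicValRat 2 (x / n) - b + 1).toNat, rfl⟩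
  have h2 := v (padicValRat 2 (x / n) - b + 1).toNat
  have h3 := Int.self_le_toNat (padicValRat 2 (x / n) - b + 1)
  dsimp only at h1
  omega

theorem mem_twoTorsionE {n : ℕ} {P : (curveE n).Point} : P ∈ twoTorsionE n ↔ 2 • P = 0 :=
  AddSubgroup.torsionBy.nsmul_iff

theorem torsionE_eq_twoTorsionE {n : ℕ} (hn : n ≠ 0) : torsionE n = twoTorsionE n := by
  refine le_antisymm (fun P hP => ?_) (twoTorsionE_le n)
  rw [mem_twoTorsionE]
  match P with
  | .zero => exact smul_zero (A := (curveE n).Point) 2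
  | .some x y h =>
    rw [curveE_two_nsmul_eq_zero_iff]
    by_contra hy
    exact curveE_not_isOfFinAddOrder hn h hy hP

theorem two_nsmul_eq_zero_of_mem_torsionE {n : ℕ} (hn : n ≠ 0) {P : (curveE n).Point}
    (hP : P ∈ torsionE n) : 2 • P = 0 := by
  rw [torsionE_eq_twoTorsionE hn] at hP
  exact mem_twoTorsionE.1 hP

theorem curveE_nonsingular_y_zero_iff {n : ℕ} (hn : n ≠ 0) {x : ℚ} :
    (curveE n).Nonsingular x 0 ↔ x = 0 ∨ x = n ∨ x = -n := by
  have hn' : (n : ℚ) ≠ 0 := by exact_mod_cast hn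
  rw [curveE_nonsingular_iff]
  constructor
  · rintro ⟨h, -⟩
    have : x * ((x - n) * (x + n)) = 0 := by linear_combination -h
    rcases mul_eq_zero.1 this with h | h
    · exact .inl h
    rcases mul_eq_zero.1 h with h | h
    · exact .inr (.inl (sub_eq_zero.1 h))
    · exact .inr (.inr (eq_neg_of_add_eq_zero_left h))
  · have hpos : 0 < (n : ℚ) ^ 2 := by positivity
    rintro (rfl | rfl | rfl)
    · exact ⟨by ring, .inl (by simpa using hpos.ne)⟩
    · exact ⟨by ring, .inl fun h => by linarith⟩
    · exact ⟨by ring, .inl fun h => by linarith⟩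

theorem mem_twoTorsionE_iff {n : ℕ} (hn : n ≠ 0) (P : (curveE n).Point) :
    P ∈ twoTorsionE n ↔ P = 0 ∨ ∃ (x : ℚ) (h : (curveE n).Nonsingular x 0),
      (x = 0 ∨ x = n ∨ x = -n) ∧ P = Affine.Point.some x 0 h := by
  rw [mem_twoTorsionE]
  match P with
  | .zero => exact iff_of_true (smul_zero (A := (curveE n).Point) 2) (.inl rfl)
  | .some x y h =>
    rw [curveE_two_nsmul_eq_zero_iff]
    constructor
    · rintro rfl
      exact .inr ⟨x, h, (curveE_nonsingular_y_zero_iff hn).1 h, rfl⟩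
    · rintro (h0 | ⟨x', h', -, e⟩)
      · exact absurd h0 (Affine.Point.some_ne_zero h)
      · rw [Affine.Point.some.injEq] at e
        exact e.2

theorem card_twoTorsionE {n : ℕ} (hn : n ≠ 0) : Nat.card (twoTorsionE n) = 4 := by
  have hn' : (n : ℚ) ≠ 0 := by exact_mod_cast hn
  have h0 := (curveE_nonsingular_y_zero_iff hn (x := 0)).2 (.inl rfl)
  have h1 := (curveE_nonsingular_y_zero_iff hn (x := n)).2 (.inr (.inl rfl))
  have h2 := (curveE_nonsingular_y_zero_iff hn (x := -n)).2 (.inr (.inr rfl))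
  have hset : (twoTorsionE n : Set (curveE n).Point) =
      {0, Affine.Point.some 0 0 h0, Affine.Point.some (n : ℚ) 0 h1,
        Affine.Point.some (-n : ℚ) 0 h2} := by
    ext P
    rw [SetLike.mem_coe, mem_twoTorsionE_iff hn]
    simp only [Set.mem_insert_iff, Set.mem_singleton_iff]
    constructor
    · rintro (rfl | ⟨x, h, rfl | rfl | rfl, rfl⟩) <;> simp
    · rintro (rfl | rfl | rfl | rfl)
      · exact .inl rfl
      · exact .inr ⟨_, h0, by simp, rfl⟩
      · exact .inr ⟨_, h1, by simp, rfl⟩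
      · exact .inr ⟨_, h2, by simp, rfl⟩
  have hnn : (n : ℚ) ≠ -n := fun h => hn' (by linarith)
  change Nat.card (twoTorsionE n : Set (curveE n).Point) = 4
  rw [hset, Nat.card_coe_set_eq, Set.ncard_insert_of_notMem, Set.ncard_insert_of_notMem,
    Set.ncard_pair]
  · simpa using hnn
  · simp [hn'.symm, hn]
  · simp [(Affine.Point.some_ne_zero _).symm]

/-! ### Torsion of `E_{1,n}` and the kernel of `φ̂₁`. -/

theorem phiHat_eq_zero_iff {n : ℕ} {P : (curveE₁ n).Point} :
    phiHat n P = 0 ↔ P = 0 ∨ ∃ (y : ℚ) (h : (curveE₁ n).Nonsingular 0 y), P = .some 0 y h := by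
  change phiHatFun n P = 0 ↔ _
  match P with
  | .zero => exact iff_of_true rfl (.inl rfl)
  | .some x y h =>
    by_cases hx : x = 0
    · subst hx
      exact iff_of_true (phiHatFun_some_zero h) (.inr ⟨y, h, rfl⟩)
    · rw [phiHatFun_some h hx]
      refine iff_of_false (Affine.Point.some_ne_zero _) ?_
      rintro (h0 | ⟨y', h', e⟩)
      · exact Affine.Point.some_ne_zero h h0
      · rw [Affine.Point.some.injEq] at e
        exact hx e.1

theorem isSquare_of_sq_eq_sixteen_mul_cube {n : ℕ} {y : ℚ} (h : y ^ 2 = 16 * (n : ℚ) ^ 3) :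
    IsSquare n := by
  by_cases hn : n = 0
  · exact ⟨0, by simp [hn]⟩
  have hn' : (n : ℚ) ≠ 0 := by exact_mod_cast hn
  rw [← Rat.isSquare_natCast_iff]
  refine ⟨y / (4 * n), ?_⟩
  field_simp
  linear_combination -h

/-- The image is torsion on `E_n`, hence `2`-torsion. If `x ≠ 0`, the `y`-coordinate `y(4n² -
x²)/(8x²)` must vanish with `y ≠ 0`, so `x = ±2n` and `y² = ±16n³`. The sign `+` makes `n` a square,
the sign `-` is impossible. This is where non-squareness does its work. -/
theorem phiHat_eq_zero_of_mem_torsionE₁ {n : ℕ} (hsq : ¬ IsSquare n) {P : (curveE₁ n).Point}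
    (hP : P ∈ torsionE₁ n) : phiHat n P = 0 := by
  have hn : n ≠ 0 := by rintro rfl; exact hsq ⟨0, rfl⟩
  have hn' : (n : ℚ) ≠ 0 := by exact_mod_cast hn
  have hQ : phiHat n P ∈ twoTorsionE n := by
    rw [← torsionE_eq_twoTorsionE hn]
    exact (phiHat n).isOfFinAddOrder hP
  match P with
  | .zero => rfl
  | .some x y h =>
    by_cases hx : x = 0
    · exact phiHat_eq_zero_iff.2 (.inr ⟨y, hx ▸ h, by subst hx; rfl⟩)
    exfalso
    have h1 := (curveE₁_nonsingular_iff.1 h).1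
    change phiHatFun n (.some x y h) ∈ twoTorsionE n at hQ
    rw [phiHatFun_some h hx, mem_twoTorsionE, curveE_two_nsmul_eq_zero_iff,
      div_eq_zero_iff] at hQ
    have hy : y ≠ 0 := by
      rintro rfl
      have hpos : 0 < x ^ 2 + 4 * (n : ℚ) ^ 2 := by positivity
      have : x * (x ^ 2 + 4 * n ^ 2) = 0 := by linarith
      rcases mul_eq_zero.1 this with h | h
      · exact hx h
      · exact hpos.ne' h
    have hx2 : 4 * (n : ℚ) ^ 2 - x ^ 2 = 0 := by
      rcases hQ with h | h
      · exact (mul_eq_zero.1 h).resolve_left hy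
      · exact absurd h (by positivity)
    have hx3 : (2 * n - x) * (2 * n + x) = 0 := by linear_combination hx2
    rcases mul_eq_zero.1 hx3 with h | h
    · obtain rfl : x = 2 * n := by linarith
      exact hsq (isSquare_of_sq_eq_sixteen_mul_cube (y := y) (by rw [h1]; ring))
    · obtain rfl : x = -(2 * n) := by linarith
      have : 0 < (n : ℚ) ^ 3 := by positivity
      nlinarith [sq_nonneg y]

theorem mem_torsionE₁_of_phiHat_eq_zero {n : ℕ} {P : (curveE₁ n).Point}
    (hP : phiHat n P = 0) : P ∈ torsionE₁ n := by
  refine isOfFinAddOrder_iff_nsmul_eq_zero.2 ⟨2, two_pos, ?_⟩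
  rw [← phiFun_phiHatFun]
  change phiFun n (phiHat n P) = 0
  rw [hP]
  rfl

theorem ker_phiHat {n : ℕ} (hsq : ¬ IsSquare n) : (phiHat n).ker = torsionE₁ n :=
  le_antisymm (fun _ hP => mem_torsionE₁_of_phiHat_eq_zero hP)
    fun _ hP => phiHat_eq_zero_of_mem_torsionE₁ hsq hP

/-- If `φ̂₁(Q)` is torsion, some multiple of `Q` lies in the torsion kernel, so `Q` is itself
torsion and is killed by `φ̂₁`. -/
theorem disjoint_torsionE_range_phiHat {n : ℕ} (hsq : ¬ IsSquare n) :
    Disjoint (torsionE n) (phiHat n).range := by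
  rw [AddSubgroup.disjoint_def]
  rintro _ hP ⟨Q, rfl⟩
  obtain ⟨m, hm, hmQ⟩ := isOfFinAddOrder_iff_nsmul_eq_zero.1 hP
  rw [← map_nsmul] at hmQ
  obtain ⟨k, hk, hkQ⟩ := isOfFinAddOrder_iff_nsmul_eq_zero.1 (mem_torsionE₁_of_phiHat_eq_zero hmQ)
  refine phiHat_eq_zero_of_mem_torsionE₁ hsq
    (isOfFinAddOrder_iff_nsmul_eq_zero.2 ⟨k * m, by positivity, ?_⟩)
  rw [mul_nsmul', hkQ]

/-! ### Naive height on `E_n`. -/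

theorem curveE_isElliptic {n : ℕ} (hn : n ≠ 0) : (curveE n).IsElliptic := by
  have hn' : (n : ℚ) ≠ 0 := by exact_mod_cast hn
  refine ⟨?_⟩
  have : WeierstrassCurve.Δ (curveE n) = 64 * (n : ℚ) ^ 6 := by
    simp only [WeierstrassCurve.Δ, WeierstrassCurve.b₂, WeierstrassCurve.b₄, WeierstrassCurve.b₆,
      WeierstrassCurve.b₈, curveE]
    ring
  rw [this, isUnit_iff_ne_zero]
  positivity

theorem eval_addSubMap_curveE (n : ℕ) (a b c : ℚ) :
    (fun i => (addSubMap (curveE n) i).eval ![a, b, c]) =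
      ![a ^ 2 + 2 * n ^ 2 * a * c + n ^ 4 * c ^ 2, 2 * b * a - 2 * n ^ 2 * b * c,
        b ^ 2 - 4 * a * c] := by
  ext i
  have b₂ : WeierstrassCurve.b₂ (curveE n) = 0 := by
    simp [WeierstrassCurve.b₂, curveE]
  have b₄ : WeierstrassCurve.b₄ (curveE n) = -2 * n ^ 2 := by
    simp [WeierstrassCurve.b₄, curveE]
  have b₆ : WeierstrassCurve.b₆ (curveE n) = 0 := by
    simp [WeierstrassCurve.b₆, curveE]
  have b₈ : WeierstrassCurve.b₈ (curveE n) = -n ^ 4 := by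
    simp [WeierstrassCurve.b₈, curveE]; ring
  fin_cases i
  · simp [addSubMap, b₄, b₆, b₈]
  · simp [addSubMap, b₂, b₄, b₆]; ring
  · simp [addSubMap]

/-- The map `addSubMap` sends `(x(P) x(Q) : x(P) + x(Q) : 1)` to
`(x(P+Q) x(P-Q) : x(P+Q) + x(P-Q) : 1)`. -/
theorem eval_addSubMap_sym2x (n : ℕ) (P Q : (curveE n).Point) :
    ∃ c : ℚ, c ≠ 0 ∧ (fun i => (addSubMap (curveE n) i).eval (P.sym2x Q)) =
      c • (P + Q).sym2x (P - Q) := by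
  match P, Q with
  | 0, 0 =>
    refine ⟨1, one_ne_zero, ?_⟩
    rw [add_zero, sub_zero, Affine.Point.sym2x_zero_zero]
    rw [eval_addSubMap_curveE]
    simp
  | 0, .some x y h =>
    refine ⟨1, one_ne_zero, ?_⟩
    rw [zero_add, zero_sub, Affine.Point.sym2x_zero_some,
      Affine.Point.sym2x_neg_right, Affine.Point.sym2x_some_some]
    rw [eval_addSubMap_curveE]
    ext i
    fin_cases i <;> simp <;> ring
  | .some x y h, 0 =>
    refine ⟨1, one_ne_zero, ?_⟩
    rw [add_zero, sub_zero, Affine.Point.sym2x_some_zero,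
      Affine.Point.sym2x_some_some]
    rw [eval_addSubMap_curveE]
    ext i
    fin_cases i <;> simp <;> ring
  | .some x₁ y₁ h₁, .some x₂ y₂ h₂ =>
    by_cases hx : x₁ = x₂
    -- Here `Q = ±P`. Since `sym2x` is symmetric and ignores signs, both cases reduce to `P = Q`.
    · have hmain : ∀ P : (curveE n).Point, P = .some x₁ y₁ h₁ →
          ∃ c : ℚ, c ≠ 0 ∧ (fun i => (addSubMap (curveE n) i).eval (P.sym2x P)) =
            c • (2 • P).sym2x 0 := by
        rintro _ rfl
        have e₁ := (curveE_nonsingular_iff.1 h₁).1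
        rw [Affine.Point.sym2x_some_some, eval_addSubMap_curveE]
        by_cases hy : y₁ = 0
        -- Here `2P = 0` and the target is `(1 : 0 : 0)`, so the scalar is the first coordinate.
        · refine ⟨(x₁ ^ 2 + n ^ 2) ^ 2, ?_, ?_⟩
          · have h2 := (curveE_nonsingular_iff.1 h₁).2.resolve_right (by simpa using hy)
            intro h0
            apply h2
            have h3 : x₁ ^ 2 + (n : ℚ) ^ 2 = 0 := pow_eq_zero_iff two_ne_zero |>.1 h0
            have h4 : x₁ ^ 2 = 0 := by nlinarith [sq_nonneg x₁, sq_nonneg (n : ℚ)]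
            linarith
          · rw [(curveE_two_nsmul_eq_zero_iff h₁).2 hy, Affine.Point.sym2x_zero_zero]
            subst hy
            ext i
            fin_cases i
            · simp; ring
            · simp; linear_combination -4 * e₁
            · simp; ring
        · obtain ⟨y', h', e⟩ := curveE_two_nsmul h₁ hy
          refine ⟨4 * y₁ ^ 2, by positivity, ?_⟩
          rw [e, Affine.Point.sym2x_some_zero]
          ext i
          fin_cases i
          · simp; field_simp; ring
          · simp; linear_combination -4 * e₁
          · simp; ring
      obtain ⟨c, hc, e⟩ := hmain _ rfl
      refine ⟨c, hc, ?_⟩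
      rcases Affine.Point.X_eq_iff (h₁ := h₁) (h₂ := h₂) |>.1 hx with h | h
      · rw [← h, sub_self, ← two_smul ℕ, e]
      · rw [show Affine.Point.some x₂ y₂ h₂ = -Affine.Point.some x₁ y₁ h₁ by rw [h, neg_neg],
          Affine.Point.sym2x_neg_right, sub_neg_eq_add, add_neg_cancel, ← two_smul ℕ,
          Affine.Point.sym2x_comm 0, e]
    · have hd : x₁ - x₂ ≠ 0 := sub_ne_zero.2 hx
      -- The target has last coordinate `1`, so the scalar is the third form, `(x₁ + x₂)² - 4x₁x₂`.
      refine ⟨(x₁ - x₂) ^ 2, by positivity, ?_⟩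
      have e₁ := (curveE_nonsingular_iff.1 h₁).1
      have e₂ := (curveE_nonsingular_iff.1 h₂).1
      rw [sub_eq_add_neg (Affine.Point.some x₁ y₁ h₁), Affine.Point.neg_some,
        Affine.Point.add_of_X_ne hx,
        Affine.Point.add_of_X_ne hx, Affine.Point.sym2x_some_some, Affine.Point.sym2x_some_some,
        eval_addSubMap_curveE, Affine.slope_of_X_ne hx, Affine.slope_of_X_ne hx]
      simp only [Affine.addX, Affine.negY, curveE]
      have X₁ : (x₁ - x₂) ^ 2 * (((y₁ - y₂) / (x₁ - x₂)) ^ 2 - x₁ - x₂) =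
          (y₁ - y₂) ^ 2 - (x₁ + x₂) * (x₁ - x₂) ^ 2 := by field_simp; ring
      have X₂ : (x₁ - x₂) ^ 2 * (((y₁ + y₂) / (x₁ - x₂)) ^ 2 - x₁ - x₂) =
          (y₁ + y₂) ^ 2 - (x₁ + x₂) * (x₁ - x₂) ^ 2 := by field_simp; ring
      ext i
      fin_cases i
      · simp
        apply mul_left_cancel₀ (pow_ne_zero 2 hd)
        have : ∀ a b : ℚ, (x₁ - x₂) ^ 2 * ((x₁ - x₂) ^ 2 * (a * b)) =
          ((x₁ - x₂) ^ 2 * a) * ((x₁ - x₂) ^ 2 * b) := by intros; ring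
        rw [this, X₁, X₂]
        have : ((y₁ - y₂) ^ 2 - (x₁ + x₂) * (x₁ - x₂) ^ 2) *
            ((y₁ + y₂) ^ 2 - (x₁ + x₂) * (x₁ - x₂) ^ 2) = (y₁ ^ 2 - y₂ ^ 2) ^ 2 -
            2 * (x₁ + x₂) * (x₁ - x₂) ^ 2 * (y₁ ^ 2 + y₂ ^ 2) +
            ((x₁ + x₂) * (x₁ - x₂) ^ 2) ^ 2 := by ring
        rw [this, e₁, e₂]
        ring
      · simp
        linear_combination -2 * e₁ - 2 * e₂ - X₁ - X₂
      · simp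
        ring

/-- Finitely many rationals have bounded height, and each `x`-coordinate comes from at most the two
points `±P`. -/
theorem northcott_logHeight_xRep (n : ℕ) :
    Northcott fun P : (curveE n).Point => Height.logHeight P.xRep := by
  refine ⟨fun B => ?_⟩
  have hfib : ∀ v : Fin 2 → ℚ, {P : (curveE n).Point | P.xRep = v}.Finite := by
    intro v
    by_cases hv : ∃ P : (curveE n).Point, P.xRep = v
    · obtain ⟨P, rfl⟩ := hv
      refine (Set.toFinite {P, -P}).subset fun Q hQ => ?_
      exact Affine.Point.eq_or_eq_neg_of_xRep_eq_xRep hQ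
    · refine Set.finite_empty.subset fun Q hQ => hv ⟨Q, hQ⟩
  have hfin : (insert ![1, 0] ((fun x : ℚ => ![x, 1]) '' {x | Height.logHeight₁ x ≤ B})).Finite :=
    ((Northcott.finite_le (h := Height.logHeight₁ (K := ℚ)) B).image _).insert _
  refine (hfin.biUnion fun v _ => hfib v).subset fun P hP => ?_
  refine Set.mem_biUnion (x := P.xRep) ?_ rfl
  match P with
  | .zero => exact .inl rfl
  | .some x y h =>
    refine .inr ⟨x, ?_, rfl⟩
    simpa [Height.logHeight₁_eq_logHeight] using hP

/-- The approximate parallelogram law for the naive height. -/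
theorem logHeight_xRep_parallelogram {n : ℕ} (hn : n ≠ 0) : ∃ C : ℝ, ∀ P Q : (curveE n).Point,
    |Height.logHeight (P + Q).xRep + Height.logHeight (P - Q).xRep -
      2 * (Height.logHeight P.xRep + Height.logHeight Q.xRep)| ≤ C := by
  have := curveE_isElliptic hn
  obtain ⟨C₁, h₁⟩ := abs_logHeight_addSubMap_sub_two_mul_logHeight_le (curveE n)
  obtain ⟨C₂, h₂⟩ := Height.abs_logHeight_sym2_sub_le ℚ
  have hsym : ∀ P Q : (curveE n).Point, |Height.logHeight (P.sym2x Q) -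
      (Height.logHeight P.xRep + Height.logHeight Q.xRep)| ≤ C₂ := by
    intro P Q
    have hvec : ∀ v : Fin 2 → ℚ, v = ![v 0, v 1] := fun v => by
      ext i; fin_cases i <;> rfl
    have := h₂ (a := P.xRep 0) (b := P.xRep 1) (c := Q.xRep 0) (d := Q.xRep 1)
      (by rw [← hvec]; exact P.xRep_ne_zero) (by rw [← hvec]; exact Q.xRep_ne_zero)
    rwa [← hvec, ← hvec] at this
  -- One `C₂` compares heights for the pair `(P + Q, P - Q)`; two more come from the pair `(P, Q)`,
  -- whose height enters doubled.
  refine ⟨C₁ + 3 * C₂, fun P Q => ?_⟩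
  obtain ⟨c, hc, e⟩ := eval_addSubMap_sym2x n P Q
  have a := h₁ (P.sym2x Q)
  rw [e, Height.logHeight_smul_eq_logHeight _ hc] at a
  have b := hsym P Q
  have d := hsym (P + Q) (P - Q)
  rw [abs_le] at *
  constructor <;> linarith

theorem curveE_fg_of_finiteIndex {n : ℕ} (hn : n ≠ 0)
    (h : (nsmulAddMonoidHom (α := (curveE n).Point) 2).range.FiniteIndex) :
    AddGroup.FG (curveE n).Point := by
  have := northcott_logHeight_xRep n
  obtain ⟨C, hC⟩ := logHeight_xRep_parallelogram hn
  exact AddCommGroup.fg_of_descent' h (fun P => Height.logHeight_nonneg P.xRep) hC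

/-! ### Complete `2`-descent and weak Mordell–Weil. -/

/-- Dividing both factors by their gcd `g` leaves coprime integers whose product is a square, so
each is a square up to sign and `d = ±g`. -/
theorem Int.exists_eq_mul_sq_of_mul_eq_sq {a b c N : ℤ} (h : a * b = c ^ 2) (ha : a ≠ 0)
    (hN : (Int.gcd a b : ℤ) ∣ N) : ∃ d s : ℤ, d ∣ N ∧ a = d * s ^ 2 := by
  have hg : 0 < Int.gcd a b := Int.gcd_pos_of_ne_zero_left _ ha
  have hg0 : (Int.gcd a b : ℤ) ≠ 0 := by exact_mod_cast hg.ne'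
  obtain ⟨a', ha'⟩ := Int.gcd_dvd_left a b
  obtain ⟨b', hb'⟩ := Int.gcd_dvd_right a b
  have hcop : Int.gcd a' b' = 1 := by
    have h1 := Int.gcd_mul_left (Int.gcd a b) a' b'
    rw [← ha', ← hb', Int.natAbs_natCast] at h1
    exact Nat.eq_of_mul_eq_mul_left hg (by rw [← h1, mul_one])
  generalize (Int.gcd a b : ℤ) = g at *
  have hc : g ∣ c := by
    rw [← Int.pow_dvd_pow_iff two_ne_zero, ← h, ha', hb']
    exact ⟨a' * b', by ring⟩
  obtain ⟨c', rfl⟩ := hc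
  have h' : a' * b' = c' ^ 2 := by
    apply mul_left_cancel₀ (pow_ne_zero 2 hg0)
    rw [ha', hb'] at h
    linear_combination h
  obtain ⟨s, hs⟩ := Int.sq_of_gcd_eq_one hcop h'
  rcases hs with hs | hs
  · exact ⟨g, s, hN, by rw [ha', hs]⟩
  · exact ⟨-g, s, (neg_dvd).2 hN, by rw [ha', hs]; ring⟩

/-- Write `x = u/w` in lowest terms. Then `x - e` has the square class of `w(u - ew)`, and the
product of this with `(u - fw)(u - hw)` is the square `(yw²)²`. It remains to bound the gcd of the
two factors. -/
theorem Rat.exists_sub_eq_mul_sq {e f h : ℤ} {x y : ℚ} (hxy : y ^ 2 = (x - e) * (x - f) * (x - h))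
    (hx : x ≠ e) : ∃ (d : ℤ) (s : ℚ), d ∣ (e - f) * (e - h) ∧ x - e = d * s ^ 2 := by
  have hw0 : (x.den : ℚ) ≠ 0 := by exact_mod_cast x.den_nz
  have hxw : x * x.den = x.num := Rat.mul_den_eq_num x
  have hcop : IsCoprime x.num (x.den : ℤ) := by
    rw [Int.isCoprime_iff_gcd_eq_one]; exact x.reduced
  have hsub : ∀ m : ℤ, ((x.num - m * x.den : ℤ) : ℚ) = (x - m) * x.den := by
    intro m; push_cast; rw [sub_mul, hxw]
  generalize hu : x.num = u at *
  generalize hw : (x.den : ℤ) = w at *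
  have hw' : (x.den : ℚ) = w := by rw [← hw]; norm_cast
  rw [hw'] at hw0 hxw
  simp only [hw'] at hsub
  have hsq : IsSquare (((w * (u - e * w)) * ((u - f * w) * (u - h * w)) : ℤ) : ℚ) := by
    refine ⟨y * w ^ 2, ?_⟩
    rw [Int.cast_mul, Int.cast_mul, Int.cast_mul, hsub, hsub, hsub]
    linear_combination -(w : ℚ) ^ 4 * hxy
  rw [Rat.isSquare_intCast_iff] at hsq
  obtain ⟨c, hc⟩ := hsq
  have hcopm : ∀ m : ℤ, IsCoprime (u - m * w) w := by
    intro m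
    rw [sub_eq_add_neg, ← neg_mul]
    exact IsCoprime.add_mul_right_left hcop (-m)
  have hdvd : ∀ {g m : ℤ}, g ∣ u - e * w → g ∣ u - m * w → g ∣ e - m := by
    intro g m h1 h2
    have h3 : g ∣ (e - m) * w := by
      have := dvd_sub h2 h1
      rwa [show u - m * w - (u - e * w) = (e - m) * w by ring] at this
    exact ((hcopm e).of_isCoprime_of_dvd_left h1).dvd_of_dvd_mul_right h3
  have hgcd : (Int.gcd (w * (u - e * w)) ((u - f * w) * (u - h * w)) : ℤ) ∣
      (e - f) * (e - h) := by
    have h1 : IsCoprime w ((u - f * w) * (u - h * w)) :=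
      IsCoprime.mul_right (hcopm f).symm (hcopm h).symm
    have hL := Int.gcd_dvd_left (w * (u - e * w)) ((u - f * w) * (u - h * w))
    have hR := Int.gcd_dvd_right (w * (u - e * w)) ((u - f * w) * (u - h * w))
    generalize (Int.gcd (w * (u - e * w)) ((u - f * w) * (u - h * w)) : ℤ) = g at hL hR
    -- The gcd is prime to `w`, so it divides `u - ew`. It splits into a divisor of `u - fw` and one
    -- of `u - hw`, which therefore divide `e - f` and `e - h`.
    have hg : g ∣ u - e * w :=
      (h1.symm.of_isCoprime_of_dvd_left hR).dvd_of_dvd_mul_left hL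
    obtain ⟨g₁, g₂, hg₁, hg₂, rfl⟩ := exists_dvd_and_dvd_of_dvd_mul hR
    exact mul_dvd_mul (hdvd ((dvd_mul_right _ _).trans hg) hg₁)
      (hdvd ((dvd_mul_left _ _).trans hg) hg₂)
  have hne : w * (u - e * w) ≠ 0 := by
    have h1 : ((w * (u - e * w) : ℤ) : ℚ) ≠ 0 := by
      rw [Int.cast_mul, hsub]
      exact mul_ne_zero hw0 (mul_ne_zero (sub_ne_zero.2 hx) hw0)
    exact_mod_cast h1
  obtain ⟨d, s, hd, hs⟩ := Int.exists_eq_mul_sq_of_mul_eq_sq (hc.trans (sq c).symm) hne hgcd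
  refine ⟨d, s / w, hd, ?_⟩
  have h2 : ((w * (u - e * w) : ℤ) : ℚ) = ((d * s ^ 2 : ℤ) : ℚ) := by rw [hs]
  rw [Int.cast_mul, hsub] at h2
  push_cast at h2
  field_simp
  linear_combination h2

/-- A rational point on `E_n` is divisible by two if `x`, `x - n` and `x + n` are squares. -/
theorem curveE_exists_two_nsmul_eq {n : ℕ} (hn : n ≠ 0) {x y : ℚ} (h : (curveE n).Nonsingular x y)
    (h₀ : IsSquare x) (h₁ : IsSquare (x - n)) (h₂ : IsSquare (x + n)) :
    ∃ P : (curveE n).Point, 2 • P = .some x y h := by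
  have hn' : (n : ℚ) ≠ 0 := by exact_mod_cast hn
  have e := (curveE_nonsingular_iff.1 h).1
  obtain ⟨a, ha⟩ := h₀
  obtain ⟨b, hb⟩ := h₁
  obtain ⟨c, hc, hy⟩ : ∃ c, x + n = c * c ∧ y = a * b * c := by
    obtain ⟨c, hc⟩ := h₂
    have : (y - a * b * c) * (y + a * b * c) = 0 := by
      linear_combination e + (x ^ 2 - n ^ 2) * ha + a ^ 2 * (x + n) * hb + a ^ 2 * b ^ 2 * hc
    rcases mul_eq_zero.1 this with h | h
    · exact ⟨c, hc, by linear_combination h⟩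
    · exact ⟨-c, by rw [hc]; ring, by linear_combination h⟩
  have hab : a + b ≠ 0 := fun h0 => hn' (by linear_combination ha - hb + (a - b) * h0)
  have hac : a + c ≠ 0 := fun h0 => hn' (by linear_combination hc - ha - (a - c) * h0)
  have hbc : b + c ≠ 0 := fun h0 => by
    have : 2 * (n : ℚ) = 0 := by linear_combination hc - hb - (b - c) * h0
    exact hn' (by linarith)
  have hY : (a + b) * (a + c) * (b + c) ≠ 0 := mul_ne_zero (mul_ne_zero hab hac) hbc
  have hn1 : (n : ℚ) = a ^ 2 - b ^ 2 := by linear_combination ha - hb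
  have hn2 : c ^ 2 = 2 * a ^ 2 - b ^ 2 := by linear_combination 2 * ha - hb - hc
  obtain rfl : x = a ^ 2 := by rw [ha]; ring
  -- With `x = a²`, `x - n = b²`, `x + n = c²` and signs fixed by `y = abc`, the half is
  -- `((a+b)(a+c), (a+b)(a+c)(b+c))`, where the tangent has slope `a + b + c`.
  have hP : (curveE n).Nonsingular (a ^ 2 + a * b + a * c + b * c)
      ((a + b) * (a + c) * (b + c)) := by
    rw [curveE_nonsingular_iff]
    refine ⟨?_, .inr hY⟩
    rw [hn1]
    grind
  refine ⟨.some _ _ hP, ?_⟩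
  have hyn : (a + b) * (a + c) * (b + c) ≠
      (curveE n).negY (a ^ 2 + a * b + a * c + b * c) ((a + b) * (a + c) * (b + c)) := by
    simp only [Affine.negY, curveE]
    intro h
    apply hY
    linarith
  have hsl : (curveE n).slope (a ^ 2 + a * b + a * c + b * c) (a ^ 2 + a * b + a * c + b * c)
      ((a + b) * (a + c) * (b + c)) ((a + b) * (a + c) * (b + c)) = a + b + c := by
    rw [Affine.slope_of_Y_ne rfl hyn, div_eq_iff (sub_ne_zero.2 hyn)]
    simp only [Affine.negY, curveE]
    rw [hn1]
    grind
  rw [two_smul, Affine.Point.add_self_of_Y_ne hyn, Affine.Point.some.injEq, Affine.addY,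
    Affine.negAddY, hsl]
  simp only [Affine.negY, Affine.addX, curveE]
  constructor
  · linear_combination hn2
  · rw [hy]
    linear_combination (-(a + b + c)) * hn2

/-- Restricting the cubic to the line through the two points and evaluating at the root `e` shows
that `(x₁ - e)(x₂ - e)(x₃ - e)` is the square of the line's value at `e`. The witness is that value
divided by `r`. -/
theorem isSquare_addX_sub {n : ℕ} {x₁ y₁ x₂ y₂ e f h : ℚ}
    (hcub : ∀ x : ℚ, x ^ 3 - n ^ 2 * x = (x - e) * (x - f) * (x - h))
    (h₁ : (curveE n).Nonsingular x₁ y₁) (h₂ : (curveE n).Nonsingular x₂ y₂) (hx : x₁ ≠ x₂)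
    (hsq : IsSquare ((x₁ - e) * (x₂ - e))) (hne₁ : x₁ ≠ e) (hne₂ : x₂ ≠ e) :
    IsSquare ((curveE n).addX x₁ x₂ ((curveE n).slope x₁ x₂ y₁ y₂) - e) := by
  have hd : x₁ - x₂ ≠ 0 := sub_ne_zero.2 hx
  have e₁ := (curveE_nonsingular_iff.1 h₁).1
  have e₂ := (curveE_nonsingular_iff.1 h₂).1
  rw [hcub] at e₁ e₂
  have hsum : e + f + h = 0 := by
    linear_combination (1 / 2) * hcub 1 + (1 / 2) * hcub (-1) - hcub 0
  obtain ⟨r, hr⟩ := hsq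
  have hp : (x₁ - e) * (x₂ - e) ≠ 0 := mul_ne_zero (sub_ne_zero.2 hne₁) (sub_ne_zero.2 hne₂)
  have hr0 : r ≠ 0 := by rintro rfl; exact hp (by rw [hr]; ring)
  refine ⟨((x₁ - e) * y₂ - (x₂ - e) * y₁) / (r * (x₁ - x₂)), ?_⟩
  rw [Affine.slope_of_X_ne hx, div_mul_div_comm, eq_div_iff (by positivity),
    show r * (x₁ - x₂) * (r * (x₁ - x₂)) = (x₁ - x₂) ^ 2 * (r * r) by ring, ← hr]
  simp only [Affine.addX, curveE]
  have X₁ : (x₁ - x₂) ^ 2 * (((y₁ - y₂) / (x₁ - x₂)) ^ 2 - x₁ - x₂ - e) =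
      (y₁ - y₂) ^ 2 - (x₁ + x₂ + e) * (x₁ - x₂) ^ 2 := by field_simp; ring
  obtain rfl : h = -e - f := by linear_combination hsum
  linear_combination (x₁ - e) * (x₂ - e) * X₁ + (x₂ - e) * (x₁ - x₂) * e₁
    - (x₁ - e) * (x₁ - x₂) * e₂

/-- The points with `y ≠ 0` for which `x`, `x - n` and `x + n` lie in the square classes of
the three given integers. -/
def squareClass (n : ℕ) (d : ℤ × ℤ × ℤ) : Set (curveE n).Point :=
  {P | ∃ (x y : ℚ) (h : (curveE n).Nonsingular x y), P = .some x y h ∧ y ≠ 0 ∧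
    (∃ s : ℚ, x = d.1 * s ^ 2) ∧ (∃ s : ℚ, x - n = d.2.1 * s ^ 2) ∧
    ∃ s : ℚ, x + n = d.2.2 * s ^ 2}

theorem add_mem_range_of_mem_squareClass {n : ℕ} (hn : n ≠ 0) {d : ℤ × ℤ × ℤ}
    {P Q : (curveE n).Point} (hP : P ∈ squareClass n d) (hQ : Q ∈ squareClass n d) :
    P + Q ∈ (nsmulAddMonoidHom (α := (curveE n).Point) 2).range := by
  obtain ⟨x₁, y₁, h₁, rfl, hy₁, ⟨s₁, hs₁⟩, ⟨t₁, ht₁⟩, ⟨u₁, hu₁⟩⟩ := hP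
  obtain ⟨x₂, y₂, h₂, rfl, hy₂, ⟨s₂, hs₂⟩, ⟨t₂, ht₂⟩, ⟨u₂, hu₂⟩⟩ := hQ
  by_cases hx : x₁ = x₂
  · rcases Affine.Point.X_eq_iff (h₁ := h₁) (h₂ := h₂) |>.1 hx with h | h
    · rw [h, ← two_smul ℕ]
      exact ⟨_, rfl⟩
    · rw [h, neg_add_cancel]
      exact zero_mem _
  · rw [Affine.Point.add_of_X_ne hx]
    have hroot : ∀ {x y e : ℚ}, (curveE n).Nonsingular x y → y ≠ 0 → (e = 0 ∨ e = n ∨ e = -n) →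
        x ≠ e := by
      rintro x y e h hy he rfl
      apply hy
      have := (curveE_nonsingular_iff.1 h).1
      refine pow_eq_zero_iff two_ne_zero |>.1 (this.trans ?_)
      rcases he with rfl | rfl | rfl <;> ring
    refine curveE_exists_two_nsmul_eq hn _ ?_ ?_ ?_
    · have := isSquare_addX_sub (e := 0) (f := n) (h := -n) (fun x => by ring) h₁ h₂ hx
        ⟨d.1 * s₁ * s₂, by rw [sub_zero, sub_zero, hs₁, hs₂]; ring⟩
        (hroot h₁ hy₁ (by simp)) (hroot h₂ hy₂ (by simp))
      rwa [sub_zero] at this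
    · exact isSquare_addX_sub (e := n) (f := 0) (h := -n) (fun x => by ring) h₁ h₂ hx
        ⟨d.2.1 * t₁ * t₂, by rw [ht₁, ht₂]; ring⟩
        (hroot h₁ hy₁ (by simp)) (hroot h₂ hy₂ (by simp))
    · have := isSquare_addX_sub (e := -n) (f := 0) (h := n) (fun x => by ring) h₁ h₂ hx
        ⟨d.2.2 * u₁ * u₂, by rw [sub_neg_eq_add, sub_neg_eq_add, hu₁, hu₂]; ring⟩
        (hroot h₁ hy₁ (by simp)) (hroot h₂ hy₂ (by simp))
      rwa [sub_neg_eq_add] at this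

/-- For the roots `0`, `n`, `-n` the product of differences `(e - f)(e - h)` is `-n²`, `2n²`, `2n²`;
all divide `2n²`. -/
theorem exists_mem_squareClass {n : ℕ} {x y : ℚ} (h : (curveE n).Nonsingular x y)
    (hy : y ≠ 0) : ∃ d : ℤ × ℤ × ℤ, (d.1 ∣ 2 * n ^ 2 ∧ d.2.1 ∣ 2 * n ^ 2 ∧ d.2.2 ∣ 2 * n ^ 2) ∧
      Affine.Point.some x y h ∈ squareClass n d := by
  have e := (curveE_nonsingular_iff.1 h).1
  have hy2 : y ^ 2 ≠ 0 := pow_ne_zero 2 hy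
  obtain ⟨d₁, s₁, hd₁, hs₁⟩ := Rat.exists_sub_eq_mul_sq (e := 0) (f := n) (h := -n) (x := x)
    (y := y) (by push_cast; linear_combination e) (by rintro rfl; apply hy2; rw [e]; simp)
  obtain ⟨d₂, s₂, hd₂, hs₂⟩ := Rat.exists_sub_eq_mul_sq (e := n) (f := 0) (h := -n) (x := x)
    (y := y) (by push_cast; linear_combination e)
    (by rintro rfl; apply hy2; rw [e]; push_cast; ring)
  obtain ⟨d₃, s₃, hd₃, hs₃⟩ := Rat.exists_sub_eq_mul_sq (e := -n) (f := 0) (h := n) (x := x)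
    (y := y) (by push_cast; linear_combination e)
    (by rintro rfl; apply hy2; rw [e]; push_cast; ring)
  refine ⟨(d₁, d₂, d₃), ⟨?_, ?_, ?_⟩, x, y, h, rfl, hy, ⟨s₁, ?_⟩, ⟨s₂, ?_⟩, ⟨s₃, ?_⟩⟩
  · exact hd₁.trans ⟨-2, by ring⟩
  · exact hd₂.trans ⟨1, by ring⟩
  · exact hd₃.trans ⟨1, by ring⟩
  · simpa using hs₁
  · simpa using hs₂
  · simpa using hs₃

/-- The weak Mordell–Weil theorem for `E_n`. -/
theorem finiteIndex_range_nsmul_two {n : ℕ} (hn : n ≠ 0) :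
    (nsmulAddMonoidHom (α := (curveE n).Point) 2).range.FiniteIndex := by
  set H := (nsmulAddMonoidHom (α := (curveE n).Point) 2).range with hH
  let D : Set ℤ := {d | d ∣ 2 * n ^ 2}
  have hD : D.Finite := by
    have h0 : (2 * n ^ 2 : ℤ) ≠ 0 := by positivity
    refine (Set.finite_Icc (-|(2 * n ^ 2 : ℤ)|) |(2 * n ^ 2 : ℤ)|).subset fun d hd => ?_
    exact abs_le.1 (Int.le_of_dvd (abs_pos.2 h0) ((abs_dvd_abs _ _).2 hd))
  have hT : (twoTorsionE n : Set (curveE n).Point).Finite :=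
    Nat.finite_of_card_ne_zero (α := twoTorsionE n) (by rw [card_twoTorsionE hn]; decide)
  -- Each square class meets at most one coset, because `-P + Q = (P + Q) - 2P`.
  have hclass : ∀ d, (QuotientAddGroup.mk' H '' squareClass n d).Finite := by
    intro d
    refine Set.Subsingleton.finite ?_
    rintro _ ⟨P, hP, rfl⟩ _ ⟨Q, hQ, rfl⟩
    refine QuotientAddGroup.eq.2 ?_
    have h1 := add_mem_range_of_mem_squareClass hn hP hQ
    have h2 : 2 • P ∈ H := ⟨P, rfl⟩
    have := H.sub_mem h1 h2
    rwa [show P + Q - 2 • P = -P + Q by rw [two_smul]; abel] at this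
  have huniv : (Set.univ : Set ((curveE n).Point ⧸ H)) ⊆
      (QuotientAddGroup.mk' H '' (twoTorsionE n : Set (curveE n).Point)) ∪
      ⋃ d ∈ D ×ˢ D ×ˢ D, QuotientAddGroup.mk' H '' squareClass n d := by
    intro q _
    obtain ⟨P, rfl⟩ := QuotientAddGroup.mk_surjective q
    match P with
    | .zero => exact .inl ⟨0, zero_mem _, rfl⟩
    | .some x y h =>
      by_cases hy : y = 0
      · exact .inl ⟨_, mem_twoTorsionE.2 ((curveE_two_nsmul_eq_zero_iff h).2 hy), rfl⟩
      · obtain ⟨d, hd, hPd⟩ := exists_mem_squareClass h hy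
        exact .inr (Set.mem_biUnion (x := d) hd ⟨_, hPd, rfl⟩)
  have : Finite ((curveE n).Point ⧸ H) := Set.finite_univ_iff.1 <|
    ((hT.image _).union ((hD.prod (hD.prod hD)).biUnion fun d _ => hclass d)).subset huniv
  exact AddSubgroup.finiteIndex_of_finite_quotient

/-- The Mordell–Weil theorem for `E_n`. -/
theorem curveE_fg {n : ℕ} (hn : n ≠ 0) : AddGroup.FG (curveE n).Point :=
  curveE_fg_of_finiteIndex hn (finiteIndex_range_nsmul_two hn)

/-! ### Existence of compatible complements. -/

theorem card_torsionE {n : ℕ} (hn : n ≠ 0) : Nat.card (torsionE n) = 4 := by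
  rw [torsionE_eq_twoTorsionE hn, card_twoTorsionE hn]

theorem AddSubgroup.index_eq_card_of_isCompl {G : Type*} [AddCommGroup G] {H K : AddSubgroup G}
    (h : IsCompl H K) : K.index = Nat.card H := by
  rw [AddSubgroup.index_eq_card]
  refine (Nat.card_congr (Equiv.ofBijective ((QuotientAddGroup.mk' K).comp H.subtype) ⟨?_, ?_⟩)).symm
  · refine (injective_iff_map_eq_zero _).2 fun x hx => Subtype.ext ?_
    exact AddSubgroup.disjoint_def.1 h.disjoint x.2 ((QuotientAddGroup.eq_zero_iff _).1 hx)
  · intro q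
    obtain ⟨g, rfl⟩ := QuotientAddGroup.mk_surjective q
    have hg : g ∈ H ⊔ K := by rw [h.sup_eq_top]; trivial
    obtain ⟨x, hx, y, hy, rfl⟩ := AddSubgroup.mem_sup.1 hg
    exact ⟨⟨x, hx⟩, QuotientAddGroup.eq.2 (by simpa using hy)⟩

/-- The quotient `G/B` is an `𝔽₂`-space in which `T` embeds; `A` is the preimage of a linear
complement of its image. -/
theorem exists_isCompl_of_two_nsmul_mem {G : Type*} [AddCommGroup G] {T B : AddSubgroup G}
    (hB : ∀ g : G, 2 • g ∈ B) (hT : Disjoint T B) :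
    ∃ A : AddSubgroup G, IsCompl T A ∧ B ≤ A := by
  let : Module (ZMod 2) (G ⧸ B) := QuotientAddGroup.zmodModule hB
  let V : Submodule (ZMod 2) (G ⧸ B) :=
    AddSubgroup.toZModSubmodule 2 (T.map (QuotientAddGroup.mk' B))
  obtain ⟨C, hC⟩ := V.exists_isCompl
  let A : AddSubgroup G := C.toAddSubgroup.comap (QuotientAddGroup.mk' B)
  have hBA : B ≤ A := by
    intro b hb
    change QuotientAddGroup.mk' B b ∈ C
    rw [show QuotientAddGroup.mk' B b = 0 from (QuotientAddGroup.eq_zero_iff b).2 hb]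
    exact zero_mem C
  refine ⟨A, IsCompl.of_le ?_ ?_, hBA⟩
  · rintro x ⟨hxT, hxA⟩
    have h0 : QuotientAddGroup.mk' B x = 0 :=
      (Submodule.disjoint_def.1 hC.disjoint) _ (show _ ∈ V from ⟨x, hxT, rfl⟩) hxA
    exact (AddSubgroup.disjoint_def.1 hT hxT ((QuotientAddGroup.eq_zero_iff x).1 h0))
  · intro x _
    have hx : QuotientAddGroup.mk' B x ∈ V ⊔ C := by rw [hC.sup_eq_top]; trivial
    obtain ⟨v, ⟨t, ht, rfl⟩, c, hc, hvc⟩ := Submodule.mem_sup.1 hx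
    refine AddSubgroup.mem_sup.2 ⟨t, ht, x - t, ?_, by abel⟩
    change QuotientAddGroup.mk' B (x - t) ∈ C
    rwa [map_sub, ← hvc, add_sub_cancel_left]

/-- A homomorphism onto a free abelian group splits: its kernel has a complement. -/
theorem AddMonoidHom.exists_isCompl_ker {G H : Type*} [AddCommGroup G] [AddCommGroup H]
    [Module.Free ℤ H] (f : G →+ H) (hf : Function.Surjective f) :
    ∃ A : AddSubgroup G, IsCompl f.ker A := by
  obtain ⟨s, hs⟩ := Module.projective_lifting_property f.toIntLinearMap LinearMap.id hf
  have hs' : ∀ y, f (s y) = y := fun y => LinearMap.congr_fun hs y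
  refine ⟨s.toAddMonoidHom.range, IsCompl.of_le ?_ ?_⟩
  · rintro _ ⟨hx, ⟨y, rfl⟩⟩
    have : y = 0 := (hs' y).symm.trans hx
    change s y = 0
    rw [this, map_zero]
  · intro x _
    refine AddSubgroup.mem_sup.2 ⟨x - s (f x), ?_, s (f x), ⟨f x, rfl⟩, by abel⟩
    rw [AddMonoidHom.mem_ker, map_sub, hs', sub_self]

/-- A finitely generated torsion-free abelian group is free. Asking only for disjointness from `T`
covers both `A` and the image of `φ̂₁`. -/
theorem free_of_disjoint_torsionE {n : ℕ} (hn : n ≠ 0) {A : AddSubgroup (curveE n).Point}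
    (hA : Disjoint (torsionE n) A) : Module.Free ℤ A ∧ Module.Finite ℤ A := by
  have : Module.Finite ℤ (curveE n).Point :=
    Module.Finite.iff_addGroup_fg.2 (curveE_fg hn)
  have hfin : Module.Finite ℤ A :=
    inferInstanceAs (Module.Finite ℤ (AddSubgroup.toIntSubmodule A))
  refine ⟨?_, hfin⟩
  have : IsAddTorsionFree A := by
    refine ⟨fun m hm a b hab => ?_⟩
    have h0 : m • ((a - b : A) : (curveE n).Point) = 0 := by
      rw [← AddSubgroup.coe_nsmul, nsmul_sub, sub_eq_zero.2 hab, AddSubgroup.coe_zero]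
    exact sub_eq_zero.1 <| Subtype.ext <| AddSubgroup.disjoint_def.1 hA
      (isOfFinAddOrder_iff_nsmul_eq_zero.2 ⟨m, Nat.pos_of_ne_zero hm, h0⟩) (a - b).2
  infer_instance

/-- Since `A` is built to contain the whole image of `φ̂₁`, any complement `A₁` of the kernel `T₁`
is compatible with it. -/
theorem nonempty_torsionSplitting {n : ℕ} (hsq : ¬ IsSquare n) : Nonempty (TorsionSplitting n) := by
  have hn : n ≠ 0 := by rintro rfl; exact hsq ⟨0, rfl⟩
  obtain ⟨A, hA, hBA⟩ := exists_isCompl_of_two_nsmul_mem (two_nsmul_mem_range_phiHat n)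
    (disjoint_torsionE_range_phiHat hsq)
  have := (free_of_disjoint_torsionE hn (disjoint_torsionE_range_phiHat hsq)).1
  obtain ⟨A₁, hA₁⟩ := (phiHat n).rangeRestrict.exists_isCompl_ker (phiHat n).rangeRestrict_surjective
  rw [AddMonoidHom.ker_rangeRestrict, ker_phiHat hsq] at hA₁
  refine ⟨⟨A, A₁, hA, hA₁, ?_⟩⟩
  rintro _ ⟨x, -, rfl⟩
  exact hBA ⟨x, rfl⟩

/-! ### Ranks and indices for an arbitrary splitting. -/

namespace TorsionSplitting

variable {n : ℕ} (D : TorsionSplitting n)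

theorem map_phiHat_A₁ (hsq : ¬ IsSquare n) : D.A₁.map (phiHat n) = (phiHat n).range := by
  refine le_antisymm (fun _ ⟨x, _, hx⟩ => ⟨x, hx⟩) ?_
  rintro _ ⟨x, rfl⟩
  have hx : x ∈ torsionE₁ n ⊔ D.A₁ := by rw [D.isCompl₁.sup_eq_top]; trivial
  obtain ⟨t, ht, a, ha, rfl⟩ := AddSubgroup.mem_sup.1 hx
  exact ⟨a, ha, by rw [map_add, phiHat_eq_zero_of_mem_torsionE₁ hsq ht, zero_add]⟩

theorem range_phiHat_le (hsq : ¬ IsSquare n) : (phiHat n).range ≤ D.A :=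
  D.map_phiHat_A₁ hsq ▸ D.map_le

/-- `φ̂₁` identifies `A₁` with the image of `φ̂₁`. -/
noncomputable def equivRange (hsq : ¬ IsSquare n) : D.A₁ ≃+ (phiHat n).range :=
  AddEquiv.ofBijective ((phiHat n).rangeRestrict.comp D.A₁.subtype) <| by
    constructor
    · rw [injective_iff_map_eq_zero]
      intro a ha
      have h0 : phiHat n a = 0 := congrArg Subtype.val ha
      exact Subtype.ext (AddSubgroup.disjoint_def.1 D.isCompl₁.disjoint
        (mem_torsionE₁_of_phiHat_eq_zero h0) a.2)
    · rintro ⟨b, hb⟩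
      rw [← D.map_phiHat_A₁ hsq] at hb
      obtain ⟨a, ha, rfl⟩ := hb
      exact ⟨⟨a, ha⟩, rfl⟩

/-- The image of `φ̂₁` lies in `A`, and doubling embeds `A` into it. -/
theorem finrank_range_phiHat (hsq : ¬ IsSquare n) :
    Module.finrank ℤ (phiHat n).range = Module.finrank ℤ D.A := by
  have hn : n ≠ 0 := by rintro rfl; exact hsq ⟨0, rfl⟩
  obtain ⟨_, _⟩ := free_of_disjoint_torsionE hn D.isCompl.disjoint
  obtain ⟨_, _⟩ := free_of_disjoint_torsionE hn (disjoint_torsionE_range_phiHat hsq)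
  apply le_antisymm
  · exact LinearMap.finrank_le_finrank_of_injective
      (f := (AddSubgroup.inclusion (D.range_phiHat_le hsq)).toIntLinearMap)
      (AddSubgroup.inclusion_injective (D.range_phiHat_le hsq))
  · let f : D.A →+ (phiHat n).range :=
      ((nsmulAddMonoidHom 2).comp D.A.subtype).codRestrict _ fun a => two_nsmul_mem_range_phiHat n a
    refine LinearMap.finrank_le_finrank_of_injective (f := f.toIntLinearMap) ?_
    refine (injective_iff_map_eq_zero f).2 fun a ha => ?_
    have h0 : 2 • (a : (curveE n).Point) = 0 := congrArg Subtype.val ha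
    exact Subtype.ext (AddSubgroup.disjoint_def.1 D.isCompl.disjoint
      (isOfFinAddOrder_iff_nsmul_eq_zero.2 ⟨2, two_pos, h0⟩) a.2)

theorem index_range_phiHat (hsq : ¬ IsSquare n) :
    (phiHat n).range.index = Nat.card (D.A ⧸ D.image) * 4 := by
  have hn : n ≠ 0 := by rintro rfl; exact hsq ⟨0, rfl⟩
  rw [← AddSubgroup.relIndex_mul_index (D.range_phiHat_le hsq),
    AddSubgroup.index_eq_card_of_isCompl D.isCompl, card_torsionE hn, ← AddSubgroup.index_eq_card,
    image, map_phiHat_A₁ D hsq]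
  rfl

/-- Because `2T = 0`, doubling `T ⊕ A` gives `2E_n(ℚ) = 2A`; the factor `4` is `[E_n(ℚ) : A] = |T|`.
-/
theorem card_modN (hn : n ≠ 0) :
    Nat.card (ModN (curveE n).Point 2) = Nat.card (ModN D.A 2) * 4 := by
  let H := (nsmulAddMonoidHom (α := (curveE n).Point) 2).range
  have hH : H ≤ D.A := by
    rintro _ ⟨x, rfl⟩
    have hx : x ∈ torsionE n ⊔ D.A := by rw [D.isCompl.sup_eq_top]; trivial
    obtain ⟨t, ht, a, ha, rfl⟩ := AddSubgroup.mem_sup.1 hx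
    change 2 • (t + a) ∈ D.A
    rw [nsmul_add, two_nsmul_eq_zero_of_mem_torsionE hn ht, zero_add]
    exact D.A.nsmul_mem ha 2
  have hrel : H.addSubgroupOf D.A = (nsmulAddMonoidHom (α := D.A) 2).range := by
    ext a
    rw [AddSubgroup.mem_addSubgroupOf]
    constructor
    · rintro ⟨x, hx⟩
      have hx' : x ∈ torsionE n ⊔ D.A := by rw [D.isCompl.sup_eq_top]; trivial
      obtain ⟨t, ht, b, hb, rfl⟩ := AddSubgroup.mem_sup.1 hx'
      refine ⟨⟨b, hb⟩, Subtype.ext ?_⟩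
      rw [← hx]
      change 2 • b = 2 • (t + b)
      rw [nsmul_add, two_nsmul_eq_zero_of_mem_torsionE hn ht, zero_add]
    · rintro ⟨b, rfl⟩
      exact ⟨b, rfl⟩
  have hcard : ∀ (G : Type) [AddCommGroup G],
      Nat.card (ModN G 2) = (nsmulAddMonoidHom (α := G) 2).range.index := by
    intro G _
    rw [AddSubgroup.index_eq_card]
    refine Nat.card_congr (QuotientAddGroup.quotientAddEquivOfEq
      (M := (LinearMap.range (LinearMap.lsmul ℤ G (2 : ℕ))).toAddSubgroup) ?_).toEquiv
    ext x
    simp only [Submodule.mem_toAddSubgroup, LinearMap.mem_range, AddMonoidHom.mem_range]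
    exact exists_congr fun y => by rw [LinearMap.lsmul_apply, natCast_zsmul]; rfl
  rw [hcard, hcard, ← AddSubgroup.relIndex_mul_index hH,
    AddSubgroup.index_eq_card_of_isCompl D.isCompl, card_torsionE hn, ← hrel]
  rfl

end TorsionSplitting

/-! ### From cardinalities to dimensions. -/

theorem finrank_eq_add_two_of_card_eq {V W : Type*} [AddCommGroup V] [Module (ZMod 2) V]
    [AddCommGroup W] [Module (ZMod 2) W] [Finite V] (h : Nat.card V = Nat.card W * 4) :
    Module.finrank (ZMod 2) V = Module.finrank (ZMod 2) W + 2 := by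
  -- `Nat.card` is `0` on infinite types, which would make the finite nonempty `V` have cardinality
  -- `0`.
  have : Finite W := Nat.finite_of_card_ne_zero fun h0 => by
    rw [h0, zero_mul] at h; exact Nat.card_pos.ne' h
  have hV := Module.natCard_eq_pow_finrank (K := ZMod 2) (V := V)
  have hW := Module.natCard_eq_pow_finrank (K := ZMod 2) (V := W)
  rw [hV, hW, Nat.card_zmod, show 4 = 2 ^ 2 from rfl, ← pow_add] at h
  exact Nat.pow_right_injective le_rfl h

theorem bijective_twoTorsionE_to_modN {n : ℕ} (hn : n ≠ 0) :
    Function.Bijective ((ModN.mkQ 2).comp (twoTorsionInclusion n)) := by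
  constructor
  · refine (injective_iff_map_eq_zero _).2 fun a ha => ?_
    obtain ⟨t, ht⟩ := (Submodule.Quotient.mk_eq_zero _).1 ha
    have h1 : 2 • (t : (curveE n).Point) = a := by
      rw [← natCast_zsmul]
      exact congrArg Subtype.val ht
    rw [two_nsmul_eq_zero_of_mem_torsionE hn t.2] at h1
    exact Subtype.ext h1.symm
  · intro q
    obtain ⟨t, rfl⟩ := Submodule.Quotient.mk_surjective _ q
    exact ⟨⟨t, torsionE_eq_twoTorsionE hn ▸ t.2⟩, rfl⟩

/-- The subgroup `φ̂₁(T₁)` is zero, so the quotient is `T`, which equals `E_n(ℚ)[2]`. -/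
theorem bijective_twoTorsionE_to_quotient_torsionImage {n : ℕ} (hsq : ¬ IsSquare n) :
    Function.Bijective ((QuotientAddGroup.mk' (torsionImage n)).comp (twoTorsionInclusion n)) := by
  have hn : n ≠ 0 := by rintro rfl; exact hsq ⟨0, rfl⟩
  constructor
  · refine (injective_iff_map_eq_zero _).2 fun a ha => ?_
    obtain ⟨t, ht, hta⟩ := (QuotientAddGroup.eq_zero_iff _).1 ha
    rw [phiHat_eq_zero_of_mem_torsionE₁ hsq ht] at hta
    exact Subtype.ext hta.symm
  · intro q
    obtain ⟨t, rfl⟩ := QuotientAddGroup.mk_surjective q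
    exact ⟨⟨t, torsionE_eq_twoTorsionE hn ▸ t.2⟩, rfl⟩

theorem proposition6p3 (n : ℕ) (hn : 1 < n) (hsq : ¬ IsSquare n) :
    -- subgroups `A`, `A₁` as required exist
    Nonempty (TorsionSplitting n) ∧
    -- for every choice of them, they are free of one and the same finite rank `r`, and the
    -- dimension formulas hold
    (∀ D : TorsionSplitting n, ∃ r : ℕ,
      (Module.Free ℤ D.A ∧ Module.Finite ℤ D.A ∧ Module.finrank ℤ D.A = r) ∧
      (Module.Free ℤ D.A₁ ∧ Module.Finite ℤ D.A₁ ∧ Module.finrank ℤ D.A₁ = r) ∧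
      Module.Finite (ZMod 2) ((curveE n).Point ⧸ (phiHat n).range) ∧
      Module.Finite (ZMod 2) (ModN (curveE n).Point 2) ∧
      (Module.finrank (ZMod 2) (D.A ⧸ D.image) : ℤ) =
        Module.finrank (ZMod 2) ((curveE n).Point ⧸ (phiHat n).range) - 2 ∧
      r = Module.finrank (ZMod 2) (ModN D.A 2) ∧
      (Module.finrank (ZMod 2) (ModN D.A 2) : ℤ) =
        Module.finrank (ZMod 2) (ModN (curveE n).Point 2) - 2) ∧
    -- `E_n(ℚ)[2]` consists of the four points `∞, (0,0), (n,0), (-n,0)`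
    (Nat.card (twoTorsionE n) = 4 ∧
      ∀ P : (curveE n).Point, P ∈ twoTorsionE n ↔ P = 0 ∨
        ∃ (x : ℚ) (h : (curveE n).Nonsingular x 0),
          (x = 0 ∨ x = n ∨ x = -n) ∧ P = WeierstrassCurve.Affine.Point.some x 0 h) ∧
    -- and it maps bijectively onto `T/2T` and onto `T/φ̂₁(T₁)`
    Function.Bijective ((ModN.mkQ 2).comp (twoTorsionInclusion n)) ∧
    Function.Bijective ((QuotientAddGroup.mk' (torsionImage n)).comp (twoTorsionInclusion n)) := by
  have hn0 : n ≠ 0 := by omega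
  refine ⟨nonempty_torsionSplitting hsq, fun D => ?_,
    ⟨card_twoTorsionE hn0, mem_twoTorsionE_iff hn0⟩, bijective_twoTorsionE_to_modN hn0,
    bijective_twoTorsionE_to_quotient_torsionImage hsq⟩
  obtain ⟨hA, hA'⟩ := free_of_disjoint_torsionE hn0 D.isCompl.disjoint
  obtain ⟨hB, hB'⟩ := free_of_disjoint_torsionE hn0 (disjoint_torsionE_range_phiHat hsq)
  let e : D.A₁ ≃ₗ[ℤ] (phiHat n).range := (D.equivRange hsq).toIntLinearEquiv
  have hcard := D.card_modN hn0
  have hM : Finite (ModN (curveE n).Point 2) := Nat.finite_of_card_ne_zero <| by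
    rw [hcard]; exact mul_ne_zero Nat.card_pos.ne' four_ne_zero
  have hR : Finite ((curveE n).Point ⧸ (phiHat n).range) := by
    have := finiteIndex_range_nsmul_two hn0
    have : (phiHat n).range.FiniteIndex := AddSubgroup.finiteIndex_of_le
      (H := (nsmulAddMonoidHom (α := (curveE n).Point) 2).range)
      (by rintro _ ⟨x, rfl⟩; exact two_nsmul_mem_range_phiHat n x)
    exact AddSubgroup.finite_quotient_of_finiteIndex
  refine ⟨Module.finrank ℤ D.A, ⟨hA, hA', rfl⟩,
    ⟨Module.Free.of_equiv e.symm, Module.Finite.equiv e.symm,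
      e.finrank_eq.trans (D.finrank_range_phiHat hsq)⟩,
    Module.Finite.of_finite, Module.Finite.of_finite, ?_, ?_, ?_⟩
  · rw [finrank_eq_add_two_of_card_eq (D.index_range_phiHat hsq)]
    push_cast; ring
  -- Freeness of `A` gives `|A/2A| = 2 ^ r`, compared here with the count of an `𝔽₂`-space by its
  -- dimension.
  · exact Nat.pow_right_injective le_rfl <| by
      have := Module.natCard_eq_pow_finrank (K := ZMod 2) (V := ModN D.A 2)
      rwa [ModN.natCard_eq, Nat.card_zmod] at this
  · rw [finrank_eq_add_two_of_card_eq hcard]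
    push_cast; ring
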